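/- Definitions. Let $c_s,\lambda\in\mathbb R$ and let $H^{\mathrm{target}}=\sum_{s=1}^r c_s\,\sigma_{s,1}\otimes\dots\otimes\sigma_{s,k}$ be a $k$-body Hamiltonian on $n$ qubits ($k\ge 2$), where for each $s$ the operators $\sigma_{s,1},\dots,\sigma_{s,k}$ act on $k$ different qubits and $\sigma_{s,j}=n_XX+n_YY+n_ZZ$ with a unit vector $(n_X,n_Y,n_Z)\in\mathbb R^3$ (depending on $s,j$). The gadget Hamiltonian on the $n$ target qubits and $rk$ auxiliary qubits is $$H^{\mathrm{gad}}=\sum_{s=1}^r\sum_{j=1}^k\tfrac12\bigl(\mathbb I-Z^{\mathrm{aux}}_{s,j}\bigr)+\lambda\sum_{s=1}^r\sum_{j=1}^k\tilde c_{s,j}\,\sigma_{s,j}^{\mathrm{target}}\otimes X^{\mathrm{aux}}_{s,j}\otimes X^{\mathrm{aux}}_{s,j+1},$$ with $j+1$ taken cyclically in $\{1,\dots,k\}$, $\tilde c_{s,1}=-(-1)^kc_s$ and $\tilde c_{s,j}=1$ for $j\ne 1$. Its terms are the operators $-\tfrac12Z^{\mathrm{aux}}_{s,j}$, with coefficient $-\tfrac12$,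 and $\lambda\tilde c_{s,j}\,\sigma_{s,j}\otimes X_{s,j}\otimes X_{s,j+1}$, with coefficient $\lambda\tilde c_{s,j}$. Let $m\ge2$. An alternating layered ansatz with $L$ layers places the $n+rk$ qubits on a line in any order; each layer cuts the line into windows of $m$ consecutive positions, those of every second layer being shifted by $\lfloor m/2\rfloor$, and applies one unitary block on each window. Incomplete windows at the ends of the line either (all) carry a block on the qubits they contain, or (all) carry no block; every qubit is acted on by at least one block. The blocks depend on parameters $\boldsymbol\theta\in\mathbb R^d$ drawn from a probability distribution. The parameter $\theta_\nu$ enters only one block, which has the form $A\,e^{-i\theta_\nu F/2}B$ with $F$ Hermitian, $F^2=\mathbb I$, $\operatorname{Tr}F=0$ (for instance a non-identity Pauli string). The quantities $A$, $B$, $\theta_\nu$ and all the other blocks are independent, and $A$, $B$ and each of the other blocks are drawn from unitary 2-designs on the qubits of their block. Let $\rho$ be a pure product state of the $n+rk$ qubits (for instance $|0\dots0\rangle\langle0\dots0|$), let $U(\boldsymbol\theta)$ be the unitary of the circuit, and let $C^{\mathrm{gad}}(\boldsymbol\theta)=\operatorname{Tr}[H^{\mathrm{gad}}U(\boldsymbol\theta)\rho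 U(\boldsymbol\theta)^\dagger]$. Let $w_\nu$ be the sum of the squares of the coefficients of those terms of $H^{\mathrm{gad}}$ whose (backward) causal cone in the circuit contains the block with the parameter $\theta_\nu$. (So $w_\nu\ge\tfrac14$ if the block is in the causal cone of some auxiliary qubit, and $w_\nu\geq\lambda^2\tilde c_{s,j}^2$ if it is in the causal cone of the corresponding term.) Statement. For every $m\ge 2$ there are $a>0$, $p\in\mathbb N$ and $K\in\mathbb R$, depending only on $m$, such that in every such situation (for all $n,r,k,L,d$, all Hamiltonians, all $\lambda$, all orders of the qubits, all $\rho$, all parameters $\nu$) $$\operatorname{Var}\!\left[\frac{\partial C^{\mathrm{gad}}(\boldsymbol\theta)}{\partial\theta_\nu}\right]\ \ge\ a\,w_\nu\,\bigl(3^{-L}\bigr)^{p}.$$ Consequently, gradients do not vanish exponentially at logarithmic depth: for every real $c$, if $L\le c\log n$ then $$\operatorname{Var}\!\left[\frac{\partial C^{\mathrm{gad}}(\boldsymbol\theta)}{\partial\theta_\nu}\right]\ \ge\ a\,w_\nu\,n^{-Kc}.$$ -/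

import Mathlib

open MeasureTheory ProbabilityTheory
open scoped Matrix BigOperators

/-! ### Local unitary 2-designs -/

noncomputable instance unitaryMeasurableSpace (ι : Type*) [Fintype ι] [DecidableEq ι] :
    MeasurableSpace (Matrix.unitaryGroup ι ℂ) := borel _

instance unitaryBorelSpace (ι : Type*) [Fintype ι] [DecidableEq ι] :
    BorelSpace (Matrix.unitaryGroup ι ℂ) := ⟨rfl⟩

instance unitaryCompactSpace (ι : Type*) [Fintype ι] [DecidableEq ι] :
    CompactSpace (Matrix.unitaryGroup ι ℂ) := by
  apply isCompact_iff_compactSpace.mp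
  have hc : IsCompact (Set.univ.pi fun _ : ι => Set.univ.pi fun _ : ι =>
      Metric.closedBall (0 : ℂ) 1) :=
    isCompact_univ_pi fun _ => isCompact_univ_pi fun _ => isCompact_closedBall 0 1
  refine IsCompact.of_isClosed_subset (X := Matrix ι ι ℂ) hc ?_ ?_
  · have h1 : IsClosed {A : Matrix ι ι ℂ | A * star A = 1} :=
      isClosed_eq (continuous_id.mul continuous_star) continuous_const
    convert h1 using 1
    ext A
    exact Matrix.mem_unitaryGroup_iff
  · intro A hA i _ j _
    simpa using entry_norm_bound_of_unitary hA i j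

/-- The normalized Haar measure on the unitary group. -/
noncomputable def unitaryHaar (ι : Type*) [Fintype ι] [DecidableEq ι] :
    Measure (Matrix.unitaryGroup ι ℂ) :=
  Measure.haarMeasure ⊤

/-- A unitary 2-design: a probability distribution on the unitary group which has the same
average as the Haar measure for every monomial (hence every polynomial) that is of degree two in
the entries of `U` and of degree two in their complex conjugates. -/
structure IsTwoDesign {ι : Type*} [Fintype ι] [DecidableEq ι]
    (η : Measure (Matrix.unitaryGroup ι ℂ)) : Prop where
  prob : IsProbabilityMeasure η
  moment : ∀ i₁ j₁ i₂ j₂ k₁ l₁ k₂ l₂ : ι,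
    ∫ U, (U : Matrix ι ι ℂ) i₁ j₁ * (U : Matrix ι ι ℂ) i₂ j₂ *
        star ((U : Matrix ι ι ℂ) k₁ l₁) * star ((U : Matrix ι ι ℂ) k₂ l₂) ∂η =
      ∫ U, (U : Matrix ι ι ℂ) i₁ j₁ * (U : Matrix ι ι ℂ) i₂ j₂ *
        star ((U : Matrix ι ι ℂ) k₁ l₁) * star ((U : Matrix ι ι ℂ) k₂ l₂) ∂(unitaryHaar ι)

/-! ### Qubit registers

A register is a finite type `Q` of qubits; its computational basis is `Q → Fin 2`, so operators
are matrices indexed by `Q → Fin 2`. -/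

/-- Operators on the qubits in `Q`. -/
abbrev QubitOp (Q : Type*) := Matrix (Q → Fin 2) (Q → Fin 2) ℂ

/-- The single-qubit operator `A` acting on the qubit `q`, tensored with the identity on the
other qubits. -/
def onQubit {Q : Type*} [Fintype Q] [DecidableEq Q] (q : Q) (A : Matrix (Fin 2) (Fin 2) ℂ) :
    QubitOp Q :=
  fun x y => if ∀ q', q' ≠ q → x q' = y q' then A (x q) (y q) else 0

def pauliX : Matrix (Fin 2) (Fin 2) ℂ := !![0, 1; 1, 0]

def pauliY : Matrix (Fin 2) (Fin 2) ℂ := !![0, -Complex.I; Complex.I, 0]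

def pauliZ : Matrix (Fin 2) (Fin 2) ℂ := !![1, 0; 0, -1]

/-- The density matrix of the pure product state `⊗_q ψ_q`. -/
def productState {Q : Type*} [Fintype Q] (ψ : Q → Fin 2 → ℂ) : QubitOp Q :=
  fun x y => (∏ q, ψ q (x q)) * star (∏ q, ψ q (y q))

/-! ### The gadget Hamiltonian -/

/-- The target qubits and the `r` auxiliary registers of `k` qubits each. -/
abbrev GadgetQubit (n r k : ℕ) := Fin n ⊕ (Fin r × Fin k)

/-- The data of a `k`-body target Hamiltonian `∑ s, c_s σ_{s,1} ⊗ ⋯ ⊗ σ_{s,k}` on `n` qubits,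
together with the strength `lam` of the perturbation. The factor `σ_{s,j}` acts on the target
qubit `site s j` and equals `n_X X + n_Y Y + n_Z Z`, where `axis s j = (n_X, n_Y, n_Z)`. -/
structure GadgetData (n r k : ℕ) where
  c : Fin r → ℝ
  site : Fin r → Fin k → Fin n
  site_injective : ∀ s, Function.Injective (site s)
  axis : Fin r → Fin k → Fin 3 → ℝ
  axis_unit : ∀ s j, ∑ a, axis s j a ^ 2 = 1
  lam : ℝ

namespace GadgetData

variable {n r k : ℕ}

/-- The single-qubit operator `σ_{s,j}`. -/
noncomputable def sigma (G : GadgetData n r k) (s : Fin r) (j : Fin k) :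
    Matrix (Fin 2) (Fin 2) ℂ :=
  (G.axis s j 0 : ℂ) • pauliX + (G.axis s j 1 : ℂ) • pauliY + (G.axis s j 2 : ℂ) • pauliZ

/-- The coefficient `c̃_{s,j}`; the first index is `j = 0` here. -/
noncomputable def cTilde (G : GadgetData n r k) (s : Fin r) (j : Fin k) : ℝ :=
  if (j : ℕ) = 0 then -(-1) ^ k * G.c s else 1

/-- The cyclic successor on the indices of an auxiliary register. -/
def next (j : Fin k) : Fin k := ⟨((j : ℕ) + 1) % k, Nat.mod_lt _ j.pos⟩

/-- `H^aux_s = ∑ j, (1 - Z_{s,j}) / 2`. -/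
noncomputable def hAux (_G : GadgetData n r k) (s : Fin r) : QubitOp (GadgetQubit n r k) :=
  ∑ j : Fin k, (1 / 2 : ℂ) • (1 - onQubit (Sum.inr (s, j)) pauliZ)

/-- `V_s = ∑ j, c̃_{s,j} σ_{s,j} ⊗ X_{s,j} ⊗ X_{s,j+1}`. -/
noncomputable def perturbation (G : GadgetData n r k) (s : Fin r) :
    QubitOp (GadgetQubit n r k) :=
  ∑ j : Fin k, (G.cTilde s j : ℂ) •
    (onQubit (Sum.inl (G.site s j)) (G.sigma s j) *
      onQubit (Sum.inr (s, j)) pauliX * onQubit (Sum.inr (s, next j)) pauliX)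

/-- `H^gad = ∑ s, H^aux_s + λ ∑ s, V_s`. -/
noncomputable def gadgetHamiltonian (G : GadgetData n r k) : QubitOp (GadgetQubit n r k) :=
  ∑ s, G.hAux s + (G.lam : ℂ) • ∑ s, G.perturbation s

/-- The labels of the non-scalar terms of `H^gad`: `Sum.inl (s, j)` stands for the term
`-(1/2) Z_{s,j}` and `Sum.inr (s, j)` for `λ c̃_{s,j} σ_{s,j} ⊗ X_{s,j} ⊗ X_{s,j+1}`. -/
abbrev Term (_G : GadgetData n r k) := (Fin r × Fin k) ⊕ (Fin r × Fin k)

/-- The real coefficient in front of a term. -/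
noncomputable def coeff (G : GadgetData n r k) : G.Term → ℝ
  | Sum.inl _ => -(1 / 2)
  | Sum.inr (s, j) => G.lam * G.cTilde s j

/-- The set of qubits on which a term acts. -/
def support (G : GadgetData n r k) : G.Term → Finset (GadgetQubit n r k)
  | Sum.inl (s, j) => {Sum.inr (s, j)}
  | Sum.inr (s, j) => {Sum.inl (G.site s j), Sum.inr (s, j), Sum.inr (s, next j)}

end GadgetData

/-! ### The alternating layered ansatz -/

/-- The geometry of an alternating layered ansatz with `L` layers (numbered in the order in which
they are applied) and blocks on `m` neighbouring qubits. The qubits are put on a line by `order`,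
and each layer cuts the line into windows of `m` consecutive positions, those of every second
layer being shifted by `m / 2`. Each window carries one block. For the windows at the ends of the
line which contain fewer than `m` qubits there are two conventions: if `truncate` is true, they
carry a block on the qubits they do contain, and otherwise they carry none. -/
structure AlternatingLayout (Q : Type*) [Fintype Q] [DecidableEq Q] (m L : ℕ) where
  order : Q ≃ Fin (Fintype.card Q)
  truncate : Bool

namespace AlternatingLayout

variable {Q : Type*} [Fintype Q] [DecidableEq Q] {m L : ℕ}

/-- The number of the window of layer `l` in which the qubit `q` lies. -/
def window (Λ : AlternatingLayout Q m L) (l : Fin L) (q : Q) : ℕ :=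
  ((Λ.order q : ℕ) + if Even (l : ℕ) then 0 else m / 2) / m

/-- The sets of qubits on which the blocks of layer `l` act. -/
def layerBlocks (Λ : AlternatingLayout Q m L) (l : Fin L) : Finset (Finset Q) :=
  (Finset.univ.image fun q => Finset.univ.filter fun q' => Λ.window l q' = Λ.window l q).filter
    fun S => Λ.truncate = true ∨ S.card = m

/-- A block, given by its layer and the set of qubits on which it acts. -/
abbrev Block (Λ : AlternatingLayout Q m L) := {b : Fin L × Finset Q // b.2 ∈ Λ.layerBlocks b.1}

/-- Every qubit is acted on by some block. -/
def Covers (Λ : AlternatingLayout Q m L) : Prop := ∀ q, ∃ b : Λ.Block, q ∈ b.1.2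

/-- The unitary group of the qubits of a block. -/
abbrev BlockUnitary (Λ : AlternatingLayout Q m L) (b : Λ.Block) :=
  Matrix.unitaryGroup ({q // q ∈ b.1.2} → Fin 2) ℂ

/-- The operator of layer `l`: the tensor product of its blocks and of the identity on the qubits
which lie in no block of this layer. -/
noncomputable def layerOp (Λ : AlternatingLayout Q m L) (W : (b : Λ.Block) → Λ.BlockUnitary b)
    (l : Fin L) : QubitOp Q :=
  fun x y =>
    (∏ S ∈ (Λ.layerBlocks l).attach,
      (W ⟨(l, S.1), S.2⟩).1 (fun q => x q.1) (fun q => y q.1)) *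
    if ∀ q, (∀ S ∈ Λ.layerBlocks l, q ∉ S) → x q = y q then 1 else 0

/-- The operator of the whole circuit, `U = U_{L-1} ⋯ U_1 U_0`. -/
noncomputable def circuitOp (Λ : AlternatingLayout Q m L)
    (W : (b : Λ.Block) → Λ.BlockUnitary b) : QubitOp Q :=
  (List.ofFn fun l : Fin L => Λ.layerOp W l).reverse.prod

/-- The qubits `q` in the backward light cone of the qubit set `T` (taken after the last layer),
just before the layers `l, l + 1, …, L - 1` are applied. -/
inductive LightCone (Λ : AlternatingLayout Q m L) (T : Finset Q) : ℕ → Q → Prop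
  | start {q : Q} (hq : q ∈ T) : LightCone Λ T L q
  | stay {l : ℕ} {q : Q} (hl : l < L) (h : LightCone Λ T (l + 1) q) : LightCone Λ T l q
  | spread {b : Λ.Block} {q q' : Q} (h : LightCone Λ T ((b.1.1 : ℕ) + 1) q)
      (hq : q ∈ b.1.2) (hq' : q' ∈ b.1.2) : LightCone Λ T (b.1.1 : ℕ) q'

/-- The block `b` lies in the causal cone of an operator acting on the qubits in `T`: one of its
outgoing qubits is in the backward light cone of `T`. -/
def InCausalCone (Λ : AlternatingLayout Q m L) (T : Finset Q) (b : Λ.Block) : Prop :=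
  ∃ q ∈ b.1.2, Λ.LightCone T ((b.1.1 : ℕ) + 1) q

/-- The random unitaries of the circuit, if the block `b₀` is the product of two parts around the
differentiated gate: `none` is the part `B` before that gate, `some b₀` is the part `A` after it,
and the others are the remaining blocks. -/
noncomputable def factors (Λ : AlternatingLayout Q m L) {d : ℕ}
    (W : (b : Λ.Block) → (Fin d → ℝ) → Λ.BlockUnitary b) (b₀ : Λ.Block)
    (A B : (Fin d → ℝ) → Λ.BlockUnitary b₀) :
    (x : Option Λ.Block) → (Fin d → ℝ) → Λ.BlockUnitary (x.getD b₀)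
  | none => B
  | some b => Function.update W b₀ A b

/-- Let the blocks `W b` depend on parameters `θ ∈ ℝ^d`, distributed according to `μ`. The
parameter `θ ν` is the angle of the gate `exp(-i θ_ν F / 2)` in the block
`b₀ = A exp(-i θ_ν F / 2) B`, where the generator `F` is a traceless Hermitian involution (such as
a Pauli string) and `θ ν` enters nowhere else. The random quantities `A`, `B`, `θ ν` and the other
blocks are independent, and each of the random unitaries is drawn from a local 2-design. -/
structure IsDesignAnsatz (Λ : AlternatingLayout Q m L) {d : ℕ}
    (W : (b : Λ.Block) → (Fin d → ℝ) → Λ.BlockUnitary b) (μ : Measure (Fin d → ℝ)) (ν : Fin d)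
    (b₀ : Λ.Block) (F : QubitOp {q // q ∈ b₀.1.2}) (A B : (Fin d → ℝ) → Λ.BlockUnitary b₀) :
    Prop where
  isHermitian : F.IsHermitian
  involution : F * F = 1
  traceless : F.trace = 0
  split : ∀ θ, (W b₀ θ).1 =
    (A θ).1 * NormedSpace.exp ((-(Complex.I * (θ ν : ℂ) / 2)) • F) * (B θ).1
  factors_update : ∀ x θ t, Λ.factors W b₀ A B x (Function.update θ ν t) = Λ.factors W b₀ A B x θ
  measurable : ∀ x, Measurable (Λ.factors W b₀ A B x)
  indep : iIndepFun (Λ.factors W b₀ A B) μ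
  indep_angle : IndepFun (fun θ => θ ν) (fun θ x => Λ.factors W b₀ A B x θ) μ
  design : ∀ x, IsTwoDesign (μ.map (Λ.factors W b₀ A B x))

end AlternatingLayout

/-! ### Cost function and its gradient -/

/-- The cost function `C(θ) = Tr[H U(θ) ρ U(θ)†]`; it is real for Hermitian `H` and `ρ`. -/
noncomputable def costFunction {Q : Type*} [Fintype Q] [DecidableEq Q] {d : ℕ}
    (H ρ : QubitOp Q) (U : (Fin d → ℝ) → QubitOp Q) (θ : Fin d → ℝ) : ℝ :=
  (Matrix.trace (H * U θ * ρ * (U θ)ᴴ)).re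

/-- The component `∂ C / ∂ θ_ν` of the gradient. -/
noncomputable def partialDeriv {d : ℕ} (C : (Fin d → ℝ) → ℝ) (ν : Fin d) (θ : Fin d → ℝ) : ℝ :=
  deriv (fun t => C (Function.update θ ν t)) (θ ν)

open Classical in
/-- The sum of the squared coefficients of those terms of `H^gad` whose causal cone contains the
block `b`. -/
noncomputable def coneWeight {n r k m L : ℕ} (G : GadgetData n r k)
    (Λ : AlternatingLayout (GadgetQubit n r k) m L) (b : Λ.Block) : ℝ :=
  ∑ T : G.Term, if Λ.InCausalCone (G.support T) b then G.coeff T ^ 2 else 0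

/-! ### Pauli strings -/

/-! Expand everything in Pauli strings and work in the Heisenberg picture. A unitary becomes a real
orthogonal matrix `pauliTransfer`, so the cost is a sum over paths of Pauli strings, one string
between any two consecutive layers. A path is weighted by the expectation of its first string in the
input state, the coefficient of its last string in the Hamiltonian, and one transfer matrix entry
per block (`trace_circuitOp`).

For a 2-design the entries of the transfer matrix are pairwise uncorrelated, and the second moment
of an entry is 1 for the pair of trivial strings, `(4 ^ |Q| - 1)⁻¹` for two nontrivial strings and 0
otherwise (`IsTwoDesign.integral_pauliTransfer_mul`). By independence different paths are
uncorrelated, so the variance of the gradient is a sum of nonnegative contributions of single paths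
(`variance_partialDeriv`). Nothing can cancel, and any selection of paths gives a lower bound. The
differentiated gate, averaged between its two surrounding designs, costs at most a factor 1/2,
whatever the distribution of its angle (`le_sum_integral_mul_twirlWeight`).

It remains to find good paths. Terms of the gadget Hamiltonian act on at most three qubits. Going
backwards from a Pauli string of such a term, keep one nontrivial qubit in every active block and
follow the light cone to the chosen block (`exists_path`). The support never exceeds three, so every
layer costs at most `4 ^ (3 * m)`. On each surviving qubit the Pauli matrix is chosen to have
squared expectation at least 1/3, which is possible since a pure state has a Bloch vector of length
1. Thus each string contributes its squared coefficient times `1/2 * (1/3) ^ 3 * 4 ^ (-3 * m * L)`.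
Distinct terms have distinct supports and their factors have unit axes, so the squared coefficients
add up to the cone weight (`coneWeight_le`). -/

/-- The single-qubit Pauli matrices `1, X, Y, Z`. -/
def pauliMatrix : Fin 4 → Matrix (Fin 2) (Fin 2) ℂ := ![1, pauliX, pauliY, pauliZ]

/-- The sign `± 1` by which two single-qubit Pauli matrices commute or anticommute. -/
def pauliSign₁ (a b : Fin 4) : ℤ := if a = 0 ∨ b = 0 ∨ a = b then 1 else -1

lemma pauliMatrix_sum_mul (i j k l : Fin 2) :
    ∑ a, pauliMatrix a i j * pauliMatrix a k l = if i = l ∧ j = k then 2 else 0 := by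
  fin_cases i <;> fin_cases j <;> fin_cases k <;> fin_cases l <;>
    simp [Fin.sum_univ_four, pauliMatrix, pauliX, pauliY, pauliZ] <;> norm_num

lemma pauliMatrix_isHermitian (a : Fin 4) : (pauliMatrix a)ᴴ = pauliMatrix a := by
  ext i j
  fin_cases a <;> fin_cases i <;> fin_cases j <;>
    simp [pauliMatrix, pauliX, pauliY, pauliZ]

lemma pauliMatrix_mul_self (a : Fin 4) : pauliMatrix a * pauliMatrix a = 1 := by
  ext i j
  fin_cases a <;> fin_cases i <;> fin_cases j <;>
    simp [pauliMatrix, pauliX, pauliY, pauliZ, Matrix.mul_apply]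

lemma pauliMatrix_mul_comm (a b : Fin 4) :
    pauliMatrix a * pauliMatrix b = (pauliSign₁ a b : ℂ) • (pauliMatrix b * pauliMatrix a) := by
  ext i j
  fin_cases a <;> fin_cases b <;> fin_cases i <;> fin_cases j <;>
    simp [pauliMatrix, pauliX, pauliY, pauliZ, pauliSign₁, Matrix.mul_apply]

lemma trace_pauliMatrix_mul (a b : Fin 4) :
    (pauliMatrix a * pauliMatrix b).trace = if a = b then 2 else 0 := by
  fin_cases a <;> fin_cases b <;>
    simp [pauliMatrix, pauliX, pauliY, pauliZ, Matrix.trace] <;> norm_num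

section Pauli

variable {Q : Type*} [Fintype Q]

/-- The tensor product of single-qubit operators. -/
def qubitTensor (A : Q → Matrix (Fin 2) (Fin 2) ℂ) : QubitOp Q :=
  fun x y => ∏ q, A q (x q) (y q)

lemma trace_qubitTensor [DecidableEq Q] (A : Q → Matrix (Fin 2) (Fin 2) ℂ) :
    (qubitTensor A).trace = ∏ q, (A q).trace := by
  simp only [Matrix.trace, Matrix.diag, qubitTensor]
  rw [Finset.prod_univ_sum, Fintype.piFinset_univ]

lemma qubitTensor_mul [DecidableEq Q] (A B : Q → Matrix (Fin 2) (Fin 2) ℂ) :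
    qubitTensor A * qubitTensor B = qubitTensor (fun q => A q * B q) := by
  ext x y
  simp only [Matrix.mul_apply, qubitTensor, ← Finset.prod_mul_distrib]
  rw [Finset.prod_univ_sum, Fintype.piFinset_univ]

lemma qubitTensor_one [DecidableEq Q] : qubitTensor (fun _ : Q => 1) = 1 := by
  ext x y
  simp only [qubitTensor, Matrix.one_apply, Finset.prod_ite_zero, Finset.prod_const_one,
    Finset.mem_univ, true_implies, funext_iff]

lemma conjTranspose_qubitTensor (A : Q → Matrix (Fin 2) (Fin 2) ℂ) :
    (qubitTensor A)ᴴ = qubitTensor (fun q => (A q)ᴴ) := by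
  ext x y
  simp [qubitTensor, Matrix.conjTranspose_apply]

/-- The Pauli string `⊗_q σ_{p q}`. -/
def pauliString (p : Q → Fin 4) : QubitOp Q := qubitTensor fun q => pauliMatrix (p q)

/-- The sign by which two Pauli strings commute or anticommute. -/
def pauliSign (p q : Q → Fin 4) : ℤ := ∏ i, pauliSign₁ (p i) (q i)

lemma pauliString_isHermitian (p : Q → Fin 4) : (pauliString p)ᴴ = pauliString p := by
  simp [pauliString, conjTranspose_qubitTensor, pauliMatrix_isHermitian]

variable [DecidableEq Q]

lemma pauliString_mul_self (p : Q → Fin 4) : pauliString p * pauliString p = 1 := by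
  simp [pauliString, qubitTensor_mul, pauliMatrix_mul_self, qubitTensor_one]

lemma pauliString_zero : pauliString (0 : Q → Fin 4) = 1 := by
  rw [← qubitTensor_one]; rfl

lemma pauliString_mul_comm (p q : Q → Fin 4) :
    pauliString p * pauliString q = (pauliSign p q : ℂ) • (pauliString q * pauliString p) := by
  simp only [pauliString, qubitTensor_mul]
  ext x y
  simp only [qubitTensor, pauliMatrix_mul_comm (p _) (q _), Matrix.smul_apply, smul_eq_mul,
    Finset.prod_mul_distrib, pauliSign]
  push_cast
  rfl

lemma trace_pauliString_mul (p q : Q → Fin 4) :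
    (pauliString p * pauliString q).trace = if p = q then 2 ^ Fintype.card Q else 0 := by
  simp only [pauliString, qubitTensor_mul, trace_qubitTensor, trace_pauliMatrix_mul,
    Finset.prod_ite_zero, Finset.prod_const, Finset.mem_univ, true_implies, funext_iff,
    Finset.card_univ]

/-- Completeness: the sum of `P ⊗ P` over all Pauli strings is a multiple of the swap operator. Both
the Pauli expansion and the Pauli twirl below are contractions of this identity. -/
lemma pauliString_sum_mul (x y z w : Q → Fin 2) :
    ∑ p : Q → Fin 4, pauliString p x y * pauliString p z w =
      if x = w ∧ y = z then 2 ^ Fintype.card Q else 0 := by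
  simp only [pauliString, qubitTensor, ← Finset.prod_mul_distrib]
  rw [← Fintype.piFinset_univ, ← Finset.prod_univ_sum (fun _ => Finset.univ)
    (fun q a => pauliMatrix a (x q) (y q) * pauliMatrix a (z q) (w q))]
  simp only [pauliMatrix_sum_mul, Finset.prod_ite_zero, Finset.prod_const, Finset.mem_univ,
    true_implies, funext_iff, Finset.card_univ, forall_and]

lemma sum_trace_smul_pauliString (O : QubitOp Q) :
    ∑ p, (pauliString p * O).trace • pauliString p = (2 : ℂ) ^ Fintype.card Q • O := by
  ext x y
  have : ∀ p : Q → Fin 4, (pauliString p * O).trace * pauliString p x y =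
      ∑ z, ∑ w, O w z * (pauliString p z w * pauliString p x y) := by
    intro p
    simp only [Matrix.trace, Matrix.diag, Matrix.mul_apply, Finset.sum_mul]
    exact Finset.sum_congr rfl fun z _ => Finset.sum_congr rfl fun w _ => by ring
  simp only [Matrix.sum_apply, Matrix.smul_apply, smul_eq_mul, this]
  rw [Finset.sum_comm]
  simp only [Finset.sum_comm (s := (Finset.univ : Finset (Q → Fin 4))), ← Finset.mul_sum,
    pauliString_sum_mul]
  rw [Finset.sum_eq_single y, Finset.sum_eq_single x] <;> simp +contextual [mul_comm]

/-- The Pauli twirl is completely depolarizing. It is what makes tracelessness of the generator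
useful later. -/
lemma sum_pauliString_conj (F : QubitOp Q) :
    ∑ p, pauliString p * F * pauliString p = ((2 : ℂ) ^ Fintype.card Q * F.trace) • 1 := by
  ext x y
  have : ∀ p : Q → Fin 4, (pauliString p * F * pauliString p) x y =
      ∑ z, ∑ w, F w z * (pauliString p x w * pauliString p z y) := by
    intro p
    simp only [Matrix.mul_apply, Finset.sum_mul]
    exact Finset.sum_congr rfl fun z _ => Finset.sum_congr rfl fun w _ => by ring
  simp only [Matrix.sum_apply, this]
  rw [Finset.sum_comm]
  simp only [Finset.sum_comm (s := (Finset.univ : Finset (Q → Fin 4))), ← Finset.mul_sum,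
    pauliString_sum_mul]
  by_cases hxy : x = y
  · subst hxy
    simp [Matrix.trace, Finset.mul_sum, mul_comm]
  · simp [hxy]

lemma trace_im_of_isHermitian_mul {ι : Type*} [Fintype ι] {A B : Matrix ι ι ℂ} (hA : Aᴴ = A)
    (hB : Bᴴ = B) : ((A * B).trace.re : ℂ) = (A * B).trace := by
  apply Complex.conj_eq_iff_re.mp
  rw [← Complex.star_def, ← Matrix.trace_conjTranspose, Matrix.conjTranspose_mul, hA, hB,
    Matrix.trace_mul_comm]

/-- The real coefficient of the Pauli string `p` in a Hermitian operator. -/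
noncomputable def pauliCoeff (O : QubitOp Q) (p : Q → Fin 4) : ℝ :=
  (pauliString p * O).trace.re / 2 ^ Fintype.card Q

lemma sum_pauliCoeff_smul {O : QubitOp Q} (hO : Oᴴ = O) :
    ∑ p, (pauliCoeff O p : ℂ) • pauliString p = O := by
  have h2 : (2 : ℂ) ^ Fintype.card Q ≠ 0 := pow_ne_zero _ two_ne_zero
  have h := sum_trace_smul_pauliString O
  apply_fun (((2 : ℂ) ^ Fintype.card Q)⁻¹ • ·) at h
  rw [smul_smul, inv_mul_cancel₀ h2, one_smul, Finset.smul_sum] at h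
  refine Eq.trans (Finset.sum_congr rfl fun p _ => ?_) h
  rw [smul_smul, pauliCoeff]
  push_cast
  rw [trace_im_of_isHermitian_mul (pauliString_isHermitian p) hO, div_eq_inv_mul]

lemma pauliCoeff_sum_smul (c : (Q → Fin 4) → ℝ) (q : Q → Fin 4) :
    pauliCoeff (∑ p, (c p : ℂ) • pauliString p) q = c q := by
  have h2 : (2 : ℝ) ^ Fintype.card Q ≠ 0 := by positivity
  rw [pauliCoeff, Finset.mul_sum, Matrix.trace_sum]
  simp only [Matrix.mul_smul, Matrix.trace_smul, trace_pauliString_mul, smul_eq_mul, mul_ite,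
    mul_zero, Finset.sum_ite_eq, Finset.mem_univ, if_true]
  rw [div_eq_iff h2, Complex.re_ofReal_mul]
  norm_cast

/-- Parseval's identity. -/
lemma sum_pauliCoeff_sq {O : QubitOp Q} (hO : Oᴴ = O) :
    ∑ p, pauliCoeff O p ^ 2 = (O * O).trace.re / 2 ^ Fintype.card Q := by
  conv_rhs => rw [← sum_pauliCoeff_smul hO]
  rw [Finset.sum_mul, Matrix.trace_sum, Complex.re_sum, Finset.sum_div]
  refine Finset.sum_congr rfl fun p _ => ?_
  rw [sum_pauliCoeff_smul hO, Matrix.smul_mul, Matrix.trace_smul, smul_eq_mul,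
    Complex.re_ofReal_mul, pauliCoeff]
  ring

/-- The Pauli transfer matrix of the map `O ↦ Uᴴ O U`. -/
noncomputable def pauliTransfer (U : QubitOp Q) : Matrix (Q → Fin 4) (Q → Fin 4) ℝ :=
  fun p' p => pauliCoeff (Uᴴ * pauliString p * U) p'

lemma conjTranspose_heisenberg (U : QubitOp Q) (p : Q → Fin 4) :
    (Uᴴ * pauliString p * U)ᴴ = Uᴴ * pauliString p * U := by
  simp [Matrix.conjTranspose_mul, pauliString_isHermitian, Matrix.mul_assoc]

lemma sum_pauliTransfer_smul (U : QubitOp Q) (p : Q → Fin 4) :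
    ∑ p', (pauliTransfer U p' p : ℂ) • pauliString p' = Uᴴ * pauliString p * U :=
  sum_pauliCoeff_smul (conjTranspose_heisenberg U p)

/-- The order is reversed because observables are conjugated as `Uᴴ O U`: the gate applied last acts
first on the observable. -/
lemma pauliTransfer_mul (U V : QubitOp Q) :
    pauliTransfer (U * V) = pauliTransfer V * pauliTransfer U := by
  ext p' p
  rw [pauliTransfer, Matrix.mul_apply]
  have : (U * V)ᴴ * pauliString p * (U * V) =
      ∑ q, ((∑ r, pauliTransfer V q r * pauliTransfer U r p : ℝ) : ℂ) • pauliString q := by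
    rw [Matrix.conjTranspose_mul]
    calc _ = Vᴴ * (Uᴴ * pauliString p * U) * V := by simp only [Matrix.mul_assoc]
      _ = _ := by
        rw [← sum_pauliTransfer_smul U p, Finset.mul_sum, Finset.sum_mul]
        simp only [Matrix.mul_smul, Matrix.smul_mul, ← sum_pauliTransfer_smul V, Finset.smul_sum,
          smul_smul]
        rw [Finset.sum_comm]
        push_cast
        simp only [Finset.sum_smul, mul_comm]
  rw [this, pauliCoeff_sum_smul]

lemma pauliTransfer_eq_of_eq {U : QubitOp Q} {p : Q → Fin 4} {c : (Q → Fin 4) → ℝ}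
    (h : Uᴴ * pauliString p * U = ∑ q, (c q : ℂ) • pauliString q) (q : Q → Fin 4) :
    pauliTransfer U q p = c q := by
  rw [pauliTransfer, h, pauliCoeff_sum_smul]

lemma pauliTransfer_eq_single {U : QubitOp Q} {p r : Q → Fin 4} {c : ℝ}
    (h : Uᴴ * pauliString p * U = (c : ℂ) • pauliString r) (q : Q → Fin 4) :
    pauliTransfer U q p = if q = r then c else 0 := by
  apply pauliTransfer_eq_of_eq
  rw [h]
  simp [ite_smul]

lemma pauliTransfer_one : pauliTransfer (1 : QubitOp Q) = 1 := by
  ext q p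
  rw [pauliTransfer_eq_single (r := p) (c := 1) (by simp), Matrix.one_apply]

lemma pauliTransfer_conjTranspose (U : QubitOp Q) :
    pauliTransfer Uᴴ = (pauliTransfer U)ᵀ := by
  ext q p
  rw [Matrix.transpose_apply, pauliTransfer, pauliTransfer, pauliCoeff, pauliCoeff,
    Matrix.conjTranspose_conjTranspose]
  congr 2
  rw [← Matrix.mul_assoc, Matrix.trace_mul_comm, Matrix.trace_mul_comm (pauliString p)]
  simp only [Matrix.mul_assoc]

/-- Conjugation by a unitary is an isometry for the trace inner product, in which the Pauli strings
are orthogonal with equal norms. -/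
lemma pauliTransfer_mul_transpose {U : QubitOp Q} (hU : U ∈ Matrix.unitaryGroup (Q → Fin 2) ℂ) :
    pauliTransfer U * (pauliTransfer U)ᵀ = 1 := by
  rw [← pauliTransfer_conjTranspose, ← pauliTransfer_mul, ← Matrix.star_eq_conjTranspose,
    Matrix.mem_unitaryGroup_iff'.mp hU, pauliTransfer_one]

lemma sum_pauliTransfer_mul {U : QubitOp Q} (hU : U ∈ Matrix.unitaryGroup (Q → Fin 2) ℂ)
    (p q : Q → Fin 4) :
    ∑ r, pauliTransfer U p r * pauliTransfer U q r = if p = q then 1 else 0 := by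
  have := congr_fun₂ (pauliTransfer_mul_transpose hU) p q
  simpa [Matrix.mul_apply, Matrix.one_apply] using this

lemma abs_pauliTransfer_le_one {U : QubitOp Q} (hU : U ∈ Matrix.unitaryGroup (Q → Fin 2) ℂ)
    (p q : Q → Fin 4) : |pauliTransfer U p q| ≤ 1 := by
  have h := sum_pauliTransfer_mul hU p p
  rw [if_pos rfl] at h
  rw [← sq_le_one_iff_abs_le_one, ← h, sq]
  exact Finset.single_le_sum (f := fun r => pauliTransfer U p r * pauliTransfer U p r)
    (fun r _ => mul_self_nonneg _) (Finset.mem_univ q)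

lemma pauliTransfer_zero_right {U : QubitOp Q} (hU : U ∈ Matrix.unitaryGroup (Q → Fin 2) ℂ)
    (p : Q → Fin 4) : pauliTransfer U p 0 = if p = 0 then 1 else 0 := by
  apply pauliTransfer_eq_single
  rw [pauliString_zero, Matrix.mul_one, ← Matrix.star_eq_conjTranspose,
    Matrix.mem_unitaryGroup_iff'.mp hU]
  simp

lemma pauliString_mem_unitaryGroup (p : Q → Fin 4) :
    pauliString p ∈ Matrix.unitaryGroup (Q → Fin 2) ℂ := by
  rw [Matrix.mem_unitaryGroup_iff, Matrix.star_eq_conjTranspose, pauliString_isHermitian,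
    pauliString_mul_self]

lemma pauliTransfer_pauliString (w q p : Q → Fin 4) :
    pauliTransfer (pauliString w) q p = if q = p then (pauliSign w p : ℝ) else 0 := by
  apply pauliTransfer_eq_single
  rw [pauliString_isHermitian, pauliString_mul_comm, Matrix.smul_mul, Matrix.mul_assoc,
    pauliString_mul_self, Matrix.mul_one]
  norm_cast

lemma pauliSign_single (i : Q) (a : Fin 4) (p : Q → Fin 4) :
    pauliSign (Pi.single i a) p = pauliSign₁ a (p i) := by
  rw [pauliSign, Finset.prod_eq_single i]
  · simp
  · intro j _ hj
    simp [hj, pauliSign₁]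
  · simp

lemma pauliSign_update (i : Q) (a : Fin 4) (w p : Q → Fin 4) (hw : w i = 0) :
    pauliSign (Function.update w i a) p = pauliSign₁ a (p i) * pauliSign w p := by
  rw [pauliSign, pauliSign, Fintype.prod_eq_mul_prod_compl i, Fintype.prod_eq_mul_prod_compl i,
    Function.update_self, hw]
  simp only [pauliSign₁, true_or, if_true, one_mul]
  congr 1
  refine Finset.prod_congr rfl fun j hj => ?_
  rw [Function.update_of_ne (by simpa using hj)]

/-- Distinct Pauli strings are distinguished by the signs of their commutation relations. -/
lemma exists_pauliSign_mul_eq_neg_one {p q : Q → Fin 4} (h : p ≠ q) :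
    ∃ w, pauliSign w p * pauliSign w q = -1 := by
  obtain ⟨i, hi⟩ := Function.ne_iff.mp h
  have : ∀ a b : Fin 4, a ≠ b → ∃ c, pauliSign₁ c a * pauliSign₁ c b = -1 := by decide
  obtain ⟨c, hc⟩ := this _ _ hi
  exact ⟨Pi.single i c, by simpa only [pauliSign_single] using hc⟩

/-- Any two nontrivial Pauli strings anticommute with a common one. -/
lemma exists_pauliSign_eq_neg_one {p q : Q → Fin 4} (hp : p ≠ 0) (hq : q ≠ 0) :
    ∃ w, pauliSign w p = -1 ∧ pauliSign w q = -1 := by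
  obtain ⟨i, hi⟩ := Function.ne_iff.mp hp
  obtain ⟨j, hj⟩ := Function.ne_iff.mp hq
  have key : ∀ a b : Fin 4, a ≠ 0 → b ≠ 0 →
      ∃ c, pauliSign₁ c a = -1 ∧ pauliSign₁ c b = -1 := by decide
  simp only [Pi.zero_apply] at hi hj
  by_cases hqi : q i = 0
  · by_cases hpj : p j = 0
    · obtain ⟨c, hc, -⟩ := key _ _ hi hi
      obtain ⟨c', hc', -⟩ := key _ _ hj hj
      have hij : i ≠ j := fun h => hi (h ▸ hpj)
      refine ⟨Function.update (Pi.single i c) j c', ?_, ?_⟩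
      · rw [pauliSign_update _ _ _ _ (by simp [hij.symm]), pauliSign_single, hc, hpj]
        simp [pauliSign₁]
      · rw [pauliSign_update _ _ _ _ (by simp [hij.symm]), pauliSign_single, hc', hqi]
        simp [pauliSign₁]
    · obtain ⟨c, hc⟩ := key _ _ hpj hj
      exact ⟨Pi.single j c, by simpa only [pauliSign_single] using hc⟩
  · obtain ⟨c, hc⟩ := key _ _ hi hqi
    exact ⟨Pi.single i c, by simpa only [pauliSign_single] using hc⟩

/-- Anticommuting Pauli strings are conjugate under a unitary. -/
lemma exists_unitary_pauliTransfer {a b : Q → Fin 4} (h : pauliSign a b = -1) :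
    ∃ V ∈ Matrix.unitaryGroup (Q → Fin 2) ℂ,
      ∀ r, pauliTransfer V r a = if r = b then 1 else 0 := by
  have hab : pauliString a * pauliString b = -(pauliString b * pauliString a) := by
    rw [pauliString_mul_comm, h]; simp
  have ha := pauliString_mul_self a
  have hb := pauliString_mul_self b
  set A := pauliString a
  set B := pauliString b
  -- For anticommuting involutions `A` and `B`, the operator `(A + B) / √2` is a Hermitian unitary
  -- that exchanges them under conjugation.
  let s : ℂ := ((Real.sqrt 2)⁻¹ : ℝ)
  have hs : s * s = 1 / 2 := by
    simp only [s]
    rw [← Complex.ofReal_mul, ← mul_inv, Real.mul_self_sqrt (by norm_num)]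
    norm_num
  have hsum : (A + B) * (A + B) = (2 : ℂ) • 1 := by
    rw [add_mul, mul_add, mul_add, ha, hb, hab, two_smul]; abel
  have hV : (s • (A + B))ᴴ = s • (A + B) := by
    rw [Matrix.conjTranspose_smul, Matrix.conjTranspose_add, pauliString_isHermitian,
      pauliString_isHermitian]
    simp [s, A, B]
  refine ⟨s • (A + B), ?_, fun r => ?_⟩
  · rw [Matrix.mem_unitaryGroup_iff, Matrix.star_eq_conjTranspose, hV, smul_mul_smul_comm, hs,
      hsum, smul_smul]
    norm_num
  · apply pauliTransfer_eq_single
    rw [hV]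
    change s • (A + B) * A * s • (A + B) = ((1 : ℝ) : ℂ) • B
    rw [Matrix.smul_mul, smul_mul_smul_comm, hs]
    have : (A + B) * A * (A + B) = (2 : ℂ) • B := by
      rw [add_mul, ha, add_mul, mul_add (B * A), Matrix.mul_assoc B A A, ha, Matrix.mul_assoc B A B,
        hab, mul_neg, ← Matrix.mul_assoc, hb, two_smul]
      simp only [Matrix.one_mul, Matrix.mul_one]
      abel
    rw [this, smul_smul]
    norm_num

end Pauli

/-! ### Second moments of the Pauli transfer matrix of a unitary 2-design -/

section TwoDesign

instance unitaryHaar_isProbabilityMeasure (ι : Type*) [Fintype ι] [DecidableEq ι] :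
    IsProbabilityMeasure (unitaryHaar ι) :=
  ⟨by rw [← TopologicalSpace.PositiveCompacts.coe_top]; exact Measure.haarMeasure_self⟩

instance unitaryHaar_isMulLeftInvariant (ι : Type*) [Fintype ι] [DecidableEq ι] :
    (unitaryHaar ι).IsMulLeftInvariant := by
  unfold unitaryHaar; infer_instance

variable {Q : Type*} [Fintype Q] [DecidableEq Q]

/-- An entry has degree one in the entries of `U` and degree one in their conjugates. Products of
two entries are therefore combinations of the monomials controlled by the 2-design property. -/
lemma ofReal_pauliTransfer (U : QubitOp Q) (p' p : Q → Fin 4) :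
    (pauliTransfer U p' p : ℂ) = ∑ x : (Q → Fin 2) × (Q → Fin 2) × (Q → Fin 2) × (Q → Fin 2),
      (pauliString p' x.1 x.2.1 * pauliString p x.2.2.1 x.2.2.2 / 2 ^ Fintype.card Q) *
        (U x.2.2.2 x.1 * star (U x.2.2.1 x.2.1)) := by
  rw [pauliTransfer, pauliCoeff]
  push_cast
  rw [trace_im_of_isHermitian_mul (pauliString_isHermitian p') (conjTranspose_heisenberg U p)]
  simp only [Fintype.sum_prod_type, Matrix.trace, Matrix.diag, Matrix.mul_apply,
    Matrix.conjTranspose_apply, Finset.mul_sum, Finset.sum_mul, Finset.sum_div]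
  refine Finset.sum_congr rfl fun a _ => Finset.sum_congr rfl fun b _ => ?_
  rw [Finset.sum_comm]
  exact Finset.sum_congr rfl fun c _ => Finset.sum_congr rfl fun d _ => by ring

lemma continuous_pauliTransfer (p' p : Q → Fin 4) :
    Continuous fun U : Matrix.unitaryGroup (Q → Fin 2) ℂ => pauliTransfer U.1 p' p := by
  have h : Continuous fun U : Matrix.unitaryGroup (Q → Fin 2) ℂ => (U : QubitOp Q) :=
    continuous_subtype_val
  unfold pauliTransfer pauliCoeff
  refine Continuous.div_const (Complex.continuous_re.comp ?_) _
  exact (continuous_const.matrix_mul ((h.matrix_conjTranspose.matrix_mul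
    continuous_const).matrix_mul h)).matrix_trace

lemma measurable_pauliTransfer (p' p : Q → Fin 4) :
    Measurable fun U : Matrix.unitaryGroup (Q → Fin 2) ℂ => pauliTransfer U.1 p' p :=
  (continuous_pauliTransfer p' p).measurable

lemma integrable_pauliTransfer_mul (η : Measure (Matrix.unitaryGroup (Q → Fin 2) ℂ))
    [IsProbabilityMeasure η] (p' p q' q : Q → Fin 4) :
    Integrable (fun U => pauliTransfer U.1 p' p * pauliTransfer U.1 q' q) η := by
  refine Integrable.of_bound ((measurable_pauliTransfer p' p).mul
    (measurable_pauliTransfer q' q)).aestronglyMeasurable 1 (ae_of_all _ fun U => ?_)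
  rw [Real.norm_eq_abs, abs_mul]
  exact mul_le_one₀ (abs_pauliTransfer_le_one U.2 _ _) (abs_nonneg _)
    (abs_pauliTransfer_le_one U.2 _ _)

lemma IsTwoDesign.integral_pauliTransfer_mul_eq
    {η : Measure (Matrix.unitaryGroup (Q → Fin 2) ℂ)} (hη : IsTwoDesign η)
    (p' p q' q : Q → Fin 4) :
    ∫ U, pauliTransfer U.1 p' p * pauliTransfer U.1 q' q ∂η =
      ∫ U, pauliTransfer U.1 p' p * pauliTransfer U.1 q' q ∂(unitaryHaar (Q → Fin 2)) := by
  have := hη.prob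
  have key : ∀ (κ : Measure (Matrix.unitaryGroup (Q → Fin 2) ℂ)) [IsProbabilityMeasure κ],
      ((∫ U, pauliTransfer U.1 p' p * pauliTransfer U.1 q' q ∂κ : ℝ) : ℂ) =
      ∑ x : (Q → Fin 2) × (Q → Fin 2) × (Q → Fin 2) × (Q → Fin 2),
      ∑ y : (Q → Fin 2) × (Q → Fin 2) × (Q → Fin 2) × (Q → Fin 2),
        (pauliString p' x.1 x.2.1 * pauliString p x.2.2.1 x.2.2.2 / 2 ^ Fintype.card Q) *
        (pauliString q' y.1 y.2.1 * pauliString q y.2.2.1 y.2.2.2 / 2 ^ Fintype.card Q) *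
        ∫ U, U.1 x.2.2.2 x.1 * U.1 y.2.2.2 y.1 * star (U.1 x.2.2.1 x.2.1) *
          star (U.1 y.2.2.1 y.2.1) ∂κ := by
    intro κ _
    have hint : ∀ a b c d e f g h : Q → Fin 2, Integrable
        (fun U : Matrix.unitaryGroup (Q → Fin 2) ℂ =>
          U.1 a b * U.1 c d * star (U.1 e f) * star (U.1 g h)) κ := by
      intro a b c d e f g h
      have hc : ∀ i j, Continuous fun U : Matrix.unitaryGroup (Q → Fin 2) ℂ => U.1 i j :=
        fun i j => continuous_subtype_val.matrix_elem i j
      refine Continuous.integrable_of_hasCompactSupport ?_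
        (HasCompactSupport.of_compactSpace _)
      exact (((hc a b).mul (hc c d)).mul (hc e f).star).mul (hc g h).star
    rw [← integral_complex_ofReal]
    push_cast
    simp only [ofReal_pauliTransfer, Finset.sum_mul_sum]
    rw [integral_finsetSum]
    · refine Finset.sum_congr rfl fun x _ => ?_
      rw [integral_finsetSum]
      · refine Finset.sum_congr rfl fun y _ => ?_
        rw [← integral_const_mul]
        refine integral_congr_ae (ae_of_all _ fun U => ?_)
        simp only
        ring
      · intro y _
        refine ((hint x.2.2.2 x.1 y.2.2.2 y.1 x.2.2.1 x.2.1 y.2.2.1 y.2.1).const_mul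
          ((pauliString p' x.1 x.2.1 * pauliString p x.2.2.1 x.2.2.2 / 2 ^ Fintype.card Q) *
        (pauliString q' y.1 y.2.1 * pauliString q y.2.2.1 y.2.2.2 / 2 ^ Fintype.card Q))).congr
          (ae_of_all _ fun U => ?_)
        simp only
        ring
    · intro x _
      refine integrable_finsetSum _ fun y _ => ?_
      refine ((hint x.2.2.2 x.1 y.2.2.2 y.1 x.2.2.1 x.2.1 y.2.2.1 y.2.1).const_mul
          ((pauliString p' x.1 x.2.1 * pauliString p x.2.2.1 x.2.2.2 / 2 ^ Fintype.card Q) *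
        (pauliString q' y.1 y.2.1 * pauliString q y.2.2.1 y.2.2.2 / 2 ^ Fintype.card Q))).congr
          (ae_of_all _ fun U => ?_)
      simp only
      ring
  apply Complex.ofReal_injective
  rw [key η, key (unitaryHaar (Q → Fin 2))]
  simp only [hη.moment]

/-- The probability with which a random unitary turns the Pauli string `p` into `p'`. -/
noncomputable def twirlWeight (p' p : Q → Fin 4) : ℝ :=
  if p = 0 ∧ p' = 0 then 1 else
    if p ≠ 0 ∧ p' ≠ 0 then ((4 : ℝ) ^ Fintype.card Q - 1)⁻¹ else 0

omit [DecidableEq Q] in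
lemma twirlWeight_nonneg (p' p : Q → Fin 4) : 0 ≤ twirlWeight p' p := by
  have : (1 : ℝ) ≤ 4 ^ Fintype.card Q := one_le_pow₀ (by norm_num)
  unfold twirlWeight
  split_ifs
  · exact zero_le_one
  · exact inv_nonneg.mpr (by linarith)
  · exact le_rfl

/-- Left invariance of the Haar measure mixes the columns, since `pauliTransfer` reverses products.
Suitable choices of `V` determine all second moments. -/
lemma unitaryHaar_integral_pauliTransfer_mul_left (V : Matrix.unitaryGroup (Q → Fin 2) ℂ)
    (p' p q' q : Q → Fin 4) :
    ∫ U, pauliTransfer U.1 p' p * pauliTransfer U.1 q' q ∂(unitaryHaar (Q → Fin 2)) =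
      ∫ U, (pauliTransfer U.1 * pauliTransfer V.1) p' p *
        (pauliTransfer U.1 * pauliTransfer V.1) q' q ∂(unitaryHaar (Q → Fin 2)) := by
  rw [← integral_mul_left_eq_self (μ := unitaryHaar (Q → Fin 2)) _ V]
  simp only [← pauliTransfer_mul]
  rfl

/-- Translate by a Pauli string that commutes with one of `p`, `q` and anticommutes with the other:
the integral changes sign. -/
lemma unitaryHaar_integral_of_ne {p q : Q → Fin 4} (h : p ≠ q) (p' q' : Q → Fin 4) :
    ∫ U, pauliTransfer U.1 p' p * pauliTransfer U.1 q' q ∂(unitaryHaar (Q → Fin 2)) = 0 := by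
  obtain ⟨w, hw⟩ := exists_pauliSign_mul_eq_neg_one h
  have h1 := unitaryHaar_integral_pauliTransfer_mul_left
    ⟨pauliString w, pauliString_mem_unitaryGroup w⟩ p' p q' q
  simp only [Matrix.mul_apply, pauliTransfer_pauliString, mul_ite, mul_zero, Finset.sum_ite_eq',
    Finset.mem_univ, if_true] at h1
  have h2 : ∀ U : Matrix.unitaryGroup (Q → Fin 2) ℂ,
      pauliTransfer U.1 p' p * (pauliSign w p : ℝ) * (pauliTransfer U.1 q' q * (pauliSign w q : ℝ))
        = -(pauliTransfer U.1 p' p * pauliTransfer U.1 q' q) := by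
    intro U
    have : (pauliSign w p : ℝ) * pauliSign w q = -1 := by exact_mod_cast hw
    linear_combination (pauliTransfer U.1 p' p * pauliTransfer U.1 q' q) * this
  simp only [h2, integral_neg] at h1
  linarith

lemma unitaryHaar_integral_eq_of_pauliSign {a b : Q → Fin 4} (h : pauliSign a b = -1)
    (p' q' : Q → Fin 4) :
    ∫ U, pauliTransfer U.1 p' a * pauliTransfer U.1 q' a ∂(unitaryHaar (Q → Fin 2)) =
      ∫ U, pauliTransfer U.1 p' b * pauliTransfer U.1 q' b ∂(unitaryHaar (Q → Fin 2)) := by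
  obtain ⟨V, hV, hr⟩ := exists_unitary_pauliTransfer h
  rw [unitaryHaar_integral_pauliTransfer_mul_left ⟨V, hV⟩]
  simp only [Matrix.mul_apply, hr, mul_ite, mul_one, mul_zero, Finset.sum_ite_eq',
    Finset.mem_univ, if_true]

/-- Two nontrivial strings need not anticommute, but both anticommute with a common third one,
through which they are compared. -/
lemma unitaryHaar_integral_eq {a b : Q → Fin 4} (ha : a ≠ 0) (hb : b ≠ 0) (p' q' : Q → Fin 4) :
    ∫ U, pauliTransfer U.1 p' a * pauliTransfer U.1 q' a ∂(unitaryHaar (Q → Fin 2)) =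
      ∫ U, pauliTransfer U.1 p' b * pauliTransfer U.1 q' b ∂(unitaryHaar (Q → Fin 2)) := by
  obtain ⟨w, hwa, hwb⟩ := exists_pauliSign_eq_neg_one ha hb
  rw [← unitaryHaar_integral_eq_of_pauliSign hwa, unitaryHaar_integral_eq_of_pauliSign hwb]

omit [DecidableEq Q] in
lemma card_pauli_sub_one_pos {p : Q → Fin 4} (hp : p ≠ 0) :
    (0 : ℝ) < 4 ^ Fintype.card Q - 1 := by
  obtain ⟨i, -⟩ := Function.ne_iff.mp hp
  have : Nonempty Q := ⟨i⟩
  have : (1 : ℝ) < 4 ^ Fintype.card Q := one_lt_pow₀ (by norm_num) Fintype.card_ne_zero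
  linarith

/-- All `4 ^ |Q| - 1` nontrivial columns give the same integral. Their sum is known pointwise: it is
the inner product of two orthonormal rows, minus the contribution of the trivial column. -/
lemma unitaryHaar_integral_self {p : Q → Fin 4} (hp : p ≠ 0) (p' q' : Q → Fin 4) :
    ((4 : ℝ) ^ Fintype.card Q - 1) *
      ∫ U, pauliTransfer U.1 p' p * pauliTransfer U.1 q' p ∂(unitaryHaar (Q → Fin 2)) =
      if p' = q' ∧ p' ≠ 0 then 1 else 0 := by
  have hcard : ((Finset.univ.erase (0 : Q → Fin 4)).card : ℝ) = (4 : ℝ) ^ Fintype.card Q - 1 := by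
    rw [Finset.card_erase_of_mem (Finset.mem_univ _), Nat.cast_sub (Finset.card_pos.mpr
      ⟨0, Finset.mem_univ _⟩)]
    simp
  calc _ = ∑ r ∈ Finset.univ.erase (0 : Q → Fin 4),
        ∫ U, pauliTransfer U.1 p' r * pauliTransfer U.1 q' r ∂(unitaryHaar (Q → Fin 2)) := by
        rw [Finset.sum_congr rfl fun r hr => unitaryHaar_integral_eq (Finset.ne_of_mem_erase hr)
          hp p' q', Finset.sum_const, nsmul_eq_mul, hcard]
    _ = ∫ _U : Matrix.unitaryGroup (Q → Fin 2) ℂ,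
        (if p' = q' ∧ p' ≠ 0 then (1 : ℝ) else 0) ∂(unitaryHaar (Q → Fin 2)) := by
        rw [← integral_finsetSum _ fun r _ => integrable_pauliTransfer_mul _ _ _ _ _]
        refine integral_congr_ae (ae_of_all _ fun U => ?_)
        simp only
        rw [Finset.sum_erase_eq_sub (Finset.mem_univ _), sum_pauliTransfer_mul U.2,
          pauliTransfer_zero_right U.2, pauliTransfer_zero_right U.2]
        by_cases h1 : p' = q'
        · subst h1; by_cases h2 : p' = 0 <;> simp [h2]
        · by_cases h2 : p' = 0
          · subst h2; simp [h1, Ne.symm h1]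
          · simp [h1, h2]
    _ = _ := by simp

/-- Second moments of the Pauli transfer matrix: distinct Pauli strings are uncorrelated, and a
nontrivial Pauli string is spread uniformly over the nontrivial ones. -/
theorem IsTwoDesign.integral_pauliTransfer_mul
    {η : Measure (Matrix.unitaryGroup (Q → Fin 2) ℂ)} (hη : IsTwoDesign η)
    (p' p q' q : Q → Fin 4) :
    ∫ U, pauliTransfer U.1 p' p * pauliTransfer U.1 q' q ∂η =
      if p' = q' ∧ p = q then twirlWeight p' p else 0 := by
  rw [hη.integral_pauliTransfer_mul_eq]
  by_cases h : p = q
  · subst h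
    by_cases hp : p = 0
    · subst hp
      have : ∀ U : Matrix.unitaryGroup (Q → Fin 2) ℂ,
          pauliTransfer U.1 p' 0 * pauliTransfer U.1 q' 0 =
            if p' = q' ∧ True then twirlWeight p' (0 : Q → Fin 4) else 0 := by
        intro U
        rw [pauliTransfer_zero_right U.2, pauliTransfer_zero_right U.2]
        by_cases h1 : p' = q'
        · subst h1; by_cases h2 : p' = 0 <;> simp [h2, twirlWeight]
        · by_cases h2 : p' = 0
          · subst h2; simp [h1, Ne.symm h1]
          · simp [h1, h2]
      simp only [this, integral_const]
      simp
    · have h1 := unitaryHaar_integral_self hp p' q'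
      have h2 := card_pauli_sub_one_pos hp
      rw [mul_comm, ← eq_div_iff h2.ne'] at h1
      rw [h1, twirlWeight]
      by_cases h3 : p' = q'
      · subst h3; by_cases h4 : p' = 0 <;> simp [h4, hp]
      · simp [h3]
  · rw [unitaryHaar_integral_of_ne h, if_neg (by tauto)]

/-- A first moment is a second moment in disguise: the entry at `(0, 0)` is constantly 1, and it is
uncorrelated with the entries of any other column. -/
lemma IsTwoDesign.integral_pauliTransfer
    {η : Measure (Matrix.unitaryGroup (Q → Fin 2) ℂ)} (hη : IsTwoDesign η)
    {p : Q → Fin 4} (hp : p ≠ 0) (p' : Q → Fin 4) : ∫ U, pauliTransfer U.1 p' p ∂η = 0 := by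
  have h := hη.integral_pauliTransfer_mul p' p 0 0
  rw [if_neg (by tauto)] at h
  simpa [pauliTransfer_zero_right (Subtype.prop _)] using h

end TwoDesign

/-! ### The derivative of a rotation gate -/

section Rotation

variable {Q : Type*} [Fintype Q] [DecidableEq Q]

/-- The gate `exp(-i t F / 2)`. -/
noncomputable def rotationGate (F : QubitOp Q) (t : ℝ) : QubitOp Q :=
  NormedSpace.exp ((-(Complex.I * (t : ℂ) / 2)) • F)

/-- The derivative of `t ↦ Gᴴ O G` for `G = exp(-i t F / 2)`. -/
noncomputable def rotationDeriv (F : QubitOp Q) (t : ℝ) (O : QubitOp Q) : QubitOp Q :=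
  (rotationGate F t)ᴴ * ((Complex.I / 2) • (F * O - O * F)) * rotationGate F t

/-- The matrix of `rotationDeriv` in the basis of Pauli strings. -/
noncomputable def rotationDerivTransfer (F : QubitOp Q) (t : ℝ) (p' p : Q → Fin 4) : ℝ :=
  pauliCoeff (rotationDeriv F t (pauliString p)) p'

lemma rotationGate_eq_exp_smul (F : QubitOp Q) (t : ℝ) :
    rotationGate F t = NormedSpace.exp (t • ((-(Complex.I / 2)) • F)) := by
  rw [rotationGate]
  congr 1
  ext x y
  simp only [Matrix.smul_apply, smul_eq_mul, Complex.real_smul]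
  ring

lemma conjTranspose_rotationGate {F : QubitOp Q} (hF : F.IsHermitian) (t : ℝ) :
    (rotationGate F t)ᴴ = NormedSpace.exp (t • ((Complex.I / 2) • F)) := by
  rw [rotationGate_eq_exp_smul, ← Matrix.exp_conjTranspose]
  congr 1
  simp [Matrix.conjTranspose_smul, hF.eq, star_div₀, neg_div]

lemma conjTranspose_rotationGate_mul {F : QubitOp Q} (hF : F.IsHermitian) (t : ℝ) :
    rotationGate F t * (rotationGate F t)ᴴ = 1 := by
  rw [conjTranspose_rotationGate hF, rotationGate_eq_exp_smul, neg_smul, smul_neg, Matrix.exp_neg,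
    Matrix.nonsing_inv_mul]
  exact (Matrix.isUnit_iff_isUnit_det _).mp (Matrix.isUnit_exp _)

lemma continuous_rotationGate (F : QubitOp Q) : Continuous (rotationGate F) := by
  let : NormedRing (QubitOp Q) := Matrix.linftyOpNormedRing
  let : NormedAlgebra ℝ (QubitOp Q) := Matrix.linftyOpNormedAlgebra
  have : rotationGate F = fun t : ℝ => NormedSpace.exp (t • ((-(Complex.I / 2)) • F)) :=
    funext fun t => rotationGate_eq_exp_smul F t
  rw [this]
  exact continuous_iff_continuousAt.mpr fun t => (hasDerivAt_exp_smul_const _ t).continuousAt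

/-- The coefficient of a Pauli string as a linear map. -/
noncomputable def pauliCoeffLinear (p : Q → Fin 4) : QubitOp Q →ₗ[ℝ] ℝ where
  toFun O := pauliCoeff O p
  map_add' A B := by simp [pauliCoeff, mul_add, add_div]
  map_smul' c A := by simp [pauliCoeff, mul_div_assoc]

/-- The product rule for `Gᴴ P G`; the two derivatives of the exponentials combine into the
commutator with the generator. -/
lemma hasDerivAt_pauliTransfer_rotationGate {F : QubitOp Q} (hF : F.IsHermitian) (t : ℝ)
    (p' p : Q → Fin 4) :
    HasDerivAt (fun t => pauliTransfer (rotationGate F t) p' p) (rotationDerivTransfer F t p' p) t := by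
  let : NormedRing (QubitOp Q) := Matrix.linftyOpNormedRing
  let : NormedAlgebra ℝ (QubitOp Q) := Matrix.linftyOpNormedAlgebra
  have h1 : HasDerivAt (fun t => rotationGate F t) (((-(Complex.I / 2)) • F) * rotationGate F t) t := by
    simp only [rotationGate_eq_exp_smul]
    exact hasDerivAt_exp_smul_const' _ t
  have h2 : HasDerivAt (fun t => (rotationGate F t)ᴴ) ((rotationGate F t)ᴴ * ((Complex.I / 2) • F)) t := by
    simp only [conjTranspose_rotationGate hF]
    exact hasDerivAt_exp_smul_const _ t
  have h3 := (h2.mul_const (pauliString p)).mul h1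
  have h4 := (LinearMap.toContinuousLinearMap
    (pauliCoeffLinear p')).hasFDerivAt.comp_hasDerivAt t h3
  refine h4.congr_deriv ?_
  change pauliCoeff _ p' = pauliCoeff _ p'
  congr 1
  rw [rotationDeriv]
  simp only [Matrix.smul_mul, Matrix.mul_smul, smul_sub, mul_sub, sub_mul, neg_smul, mul_neg,
    neg_mul, Matrix.mul_assoc, ← sub_eq_add_neg]

lemma continuous_rotationDerivTransfer (F : QubitOp Q) (p' p : Q → Fin 4) :
    Continuous fun t => rotationDerivTransfer F t p' p := by
  have h := continuous_rotationGate F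
  unfold rotationDerivTransfer pauliCoeff rotationDeriv
  refine Continuous.div_const (Complex.continuous_re.comp ?_) _
  exact (continuous_const.matrix_mul ((h.matrix_conjTranspose.matrix_mul
    continuous_const).matrix_mul h)).matrix_trace

lemma rotationDerivTransfer_zero_right (F : QubitOp Q) (t : ℝ) (p' : Q → Fin 4) :
    rotationDerivTransfer F t p' 0 = 0 := by
  simp [rotationDerivTransfer, rotationDeriv, pauliString_zero, pauliCoeff]

/-- The derivative is unitarily equivalent to a multiple of a commutator, which has trace zero. -/
lemma rotationDerivTransfer_zero_left {F : QubitOp Q} (hF : F.IsHermitian) (t : ℝ)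
    (p : Q → Fin 4) : rotationDerivTransfer F t 0 p = 0 := by
  rw [rotationDerivTransfer, pauliCoeff, pauliString_zero, Matrix.one_mul, rotationDeriv,
    Matrix.trace_mul_comm, ← Matrix.mul_assoc, conjTranspose_rotationGate_mul hF, Matrix.one_mul,
    Matrix.trace_smul, Matrix.trace_sub, Matrix.trace_mul_comm]
  simp

/-- By Parseval this is the total squared norm of the commutators `(i/2) [F, P]`; conjugation by the
gate does not change norms, so the angle disappears. If `F` is a Pauli string, it counts the strings
anticommuting with `F`, which are half of them. In general the cross term is a Pauli twirl of `F`
and vanishes with its trace. -/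
lemma sum_rotationDerivTransfer_sq {F : QubitOp Q} (hF : F.IsHermitian) (hFF : F * F = 1)
    (hF0 : F.trace = 0) (t : ℝ) :
    ∑ p, ∑ p', rotationDerivTransfer F t p' p ^ 2 = 4 ^ Fintype.card Q / 2 := by
  have h2 : (2 : ℝ) ^ Fintype.card Q ≠ 0 := pow_ne_zero _ two_ne_zero
  have hG := conjTranspose_rotationGate_mul hF t
  have key : ∀ p : Q → Fin 4, ∑ p', rotationDerivTransfer F t p' p ^ 2 =
      1 / 2 - (pauliString p * F * pauliString p * F).trace.re / (2 * 2 ^ Fintype.card Q) := by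
    intro p
    have hP := pauliString_isHermitian p
    have hPP := pauliString_mul_self p
    set P := pauliString p with hPdef
    set X : QubitOp Q := (Complex.I / 2) • (F * P - P * F) with hX
    have hXH : Xᴴ = X := by
      rw [hX, Matrix.conjTranspose_smul, Matrix.conjTranspose_sub, Matrix.conjTranspose_mul,
        Matrix.conjTranspose_mul, hP, hF.eq, ← neg_sub (F * P), smul_neg, ← neg_smul]
      congr 1
      simp [star_div₀, neg_div]
    have hYH : (rotationDeriv F t P)ᴴ = rotationDeriv F t P := by
      rw [rotationDeriv, ← hX]
      simp [Matrix.conjTranspose_mul, hXH, Matrix.mul_assoc]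
    have hYY : (rotationDeriv F t P * rotationDeriv F t P).trace = (X * X).trace := by
      rw [rotationDeriv, ← hX]
      set G := rotationGate F t
      calc (Gᴴ * X * G * (Gᴴ * X * G)).trace = (Gᴴ * (X * (G * Gᴴ) * X * G)).trace := by
            simp only [Matrix.mul_assoc]
        _ = (X * X * (G * Gᴴ)).trace := by
            rw [hG, Matrix.trace_mul_comm, Matrix.mul_one, Matrix.mul_assoc, hG]
        _ = (X * X).trace := by rw [hG, Matrix.mul_one]
    -- The squares `F * F` and `P * P` are the identity, so only the cross terms `P F P F` and `F P
    -- F P` depend on the pair.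
    have hXX : X * X = (1 / 2 : ℂ) • 1 - (1 / 4 : ℂ) • (F * (P * F * P) + P * F * P * F) := by
      have : (F * P - P * F) * (F * P - P * F) =
          F * (P * F * P) + P * F * P * F - (2 : ℂ) • 1 := by
        have e1 : F * P * (P * F) = 1 := by
          rw [← Matrix.mul_assoc, Matrix.mul_assoc F, hPP, Matrix.mul_one, hFF]
        have e2 : P * F * (F * P) = 1 := by
          rw [← Matrix.mul_assoc, Matrix.mul_assoc P, hFF, Matrix.mul_one, hPP]
        rw [mul_sub, sub_mul, sub_mul, e1, e2, two_smul]
        simp only [Matrix.mul_assoc]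
        abel
      rw [hX, smul_mul_smul_comm, this, smul_sub, smul_smul]
      have : Complex.I / 2 * (Complex.I / 2) = -(1 / 4) := by
        linear_combination (1 / 4 : ℂ) * Complex.I_mul_I
      rw [this]
      module
    calc _ = (X * X).trace.re / 2 ^ Fintype.card Q := by
          rw [← hYY, ← sum_pauliCoeff_sq hYH]
          rfl
      _ = _ := by
        rw [hXX, Matrix.trace_sub, Matrix.trace_smul, Matrix.trace_smul, Matrix.trace_add,
          Matrix.trace_mul_comm F, Matrix.trace_one]
        have : ((1 / 2 : ℂ) • ((Fintype.card (Q → Fin 2) : ℕ) : ℂ) -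
            (1 / 4 : ℂ) • ((P * F * P * F).trace + (P * F * P * F).trace)).re =
            2 ^ Fintype.card Q / 2 - (P * F * P * F).trace.re / 2 := by
          have e : ((1 / 2 : ℂ) • ((Fintype.card (Q → Fin 2) : ℕ) : ℂ) -
            (1 / 4 : ℂ) • ((P * F * P * F).trace + (P * F * P * F).trace)) =
            (((2 : ℝ) ^ Fintype.card Q / 2 : ℝ) : ℂ) -
              (((1 / 2 : ℝ) : ℂ)) * (P * F * P * F).trace := by
            simp only [Fintype.card_pi, Fintype.card_fin, Finset.prod_const, Finset.card_univ,
              smul_eq_mul]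
            push_cast
            ring
          rw [e, Complex.sub_re, Complex.ofReal_re, Complex.re_ofReal_mul]
          ring
        rw [this]
        field_simp
  simp only [key, Finset.sum_sub_distrib]
  have h0 : ∑ p : Q → Fin 4, (pauliString p * F * pauliString p * F).trace.re /
      (2 * 2 ^ Fintype.card Q) = 0 := by
    rw [← Finset.sum_div, ← Complex.re_sum, ← Matrix.trace_sum, ← Finset.sum_mul,
      sum_pauliString_conj, hF0]
    simp
  rw [h0]
  simp
  ring

/-- A crude bound from the sum of all squares; it serves only to guarantee integrability. -/
lemma abs_rotationDerivTransfer_le {F : QubitOp Q} (hF : F.IsHermitian) (hFF : F * F = 1)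
    (hF0 : F.trace = 0) (t : ℝ) (p' p : Q → Fin 4) :
    |rotationDerivTransfer F t p' p| ≤ 2 ^ Fintype.card Q := by
  apply abs_le_of_sq_le_sq _ (by positivity)
  rw [← pow_mul, mul_comm, pow_mul]
  have h := sum_rotationDerivTransfer_sq hF hFF hF0 t
  have h1 : rotationDerivTransfer F t p' p ^ 2 ≤ 4 ^ Fintype.card Q / 2 := by
    rw [← h]
    exact (Finset.single_le_sum (f := fun p' => rotationDerivTransfer F t p' p ^ 2)
      (fun _ _ => sq_nonneg _) (Finset.mem_univ p')).trans
      (Finset.single_le_sum (f := fun p => ∑ p', rotationDerivTransfer F t p' p ^ 2)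
      (fun _ _ => Finset.sum_nonneg fun _ _ => sq_nonneg _) (Finset.mem_univ p))
  have h4 : (0 : ℝ) < 4 ^ Fintype.card Q := by positivity
  norm_num
  linarith

end Rotation

/-! ### Tensor products along a partition of the qubits -/

section CellTensor

variable {Q : Type*} [Fintype Q] [DecidableEq Q] {κ : Type*} [Fintype κ] {B : κ → Finset Q}

/-- The tensor product of the operators `V c` acting on the disjoint sets `B c` of qubits. -/
def cellTensor (B : κ → Finset Q) (V : ∀ c, QubitOp {q // q ∈ B c}) : QubitOp Q :=
  fun x y => ∏ c, V c (fun q => x q.1) (fun q => y q.1)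

-- A configuration on all qubits is the same as an independent choice on each cell of a partition.
-- This turns sums over configurations of products over cells into products of sums.
omit [Fintype Q] [DecidableEq Q] [Fintype κ] in
lemma bijective_restrict_cells (hB : ∀ q, ∃! c, q ∈ B c) (α : Type*) :
    Function.Bijective (fun (z : Q → α) (c : κ) (q : {q // q ∈ B c}) => z q.1) := by
  choose c hc hc' using hB
  refine ⟨fun z w h => funext fun q => ?_, fun w => ⟨fun q => w (c q) ⟨q, hc q⟩, ?_⟩⟩
  · exact congr_fun (congr_fun h (c q)) ⟨q, hc q⟩
  · funext d q
    obtain ⟨q, hq⟩ := q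
    obtain rfl := hc' q d hq
    rfl

lemma sum_prod_restrict_cells [DecidableEq κ] (hB : ∀ q, ∃! c, q ∈ B c) {α : Type*} [Fintype α]
    (f : ∀ c, ({q // q ∈ B c} → α) → ℂ) :
    ∑ z : Q → α, ∏ c, f c (fun q => z q.1) = ∏ c, ∑ w, f c w := by
  rw [Finset.prod_univ_sum, Fintype.piFinset_univ]
  exact (bijective_restrict_cells hB α).sum_comp fun w => ∏ c, f c (w c)

omit [DecidableEq Q] in
lemma prod_cells {M : Type*} [CommMonoid M] (hB : ∀ q, ∃! c, q ∈ B c) (f : Q → M) :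
    ∏ c, ∏ q : {q // q ∈ B c}, f q.1 = ∏ q, f q := by
  classical
  choose c hc hc' using hB
  rw [← Equiv.prod_comp (Equiv.sigmaFiberEquiv c), Fintype.prod_sigma]
  refine Finset.prod_congr rfl fun d _ => ?_
  refine Fintype.prod_equiv (Equiv.subtypeEquivRight fun q => ?_) _ _ fun _ => rfl
  exact ⟨fun h => (hc' q d h).symm, fun h => h ▸ hc q⟩

lemma cellTensor_mul [DecidableEq κ] (hB : ∀ q, ∃! c, q ∈ B c)
    (V V' : ∀ c, QubitOp {q // q ∈ B c}) :
    cellTensor B V * cellTensor B V' = cellTensor B fun c => V c * V' c := by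
  ext x y
  simp only [Matrix.mul_apply, cellTensor, ← Finset.prod_mul_distrib]
  exact sum_prod_restrict_cells hB fun c w => V c (fun q => x q.1) w * V' c w fun q => y q.1

lemma trace_cellTensor [DecidableEq κ] (hB : ∀ q, ∃! c, q ∈ B c)
    (V : ∀ c, QubitOp {q // q ∈ B c}) : (cellTensor B V).trace = ∏ c, (V c).trace :=
  sum_prod_restrict_cells hB fun c w => V c w w

omit [Fintype Q] [DecidableEq Q] in
lemma conjTranspose_cellTensor (V : ∀ c, QubitOp {q // q ∈ B c}) :
    (cellTensor B V)ᴴ = cellTensor B fun c => (V c)ᴴ := by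
  ext x y
  simp [cellTensor, Matrix.conjTranspose_apply]

omit [DecidableEq Q] in
lemma cellTensor_pauliString (hB : ∀ q, ∃! c, q ∈ B c) (p : Q → Fin 4) :
    cellTensor B (fun _ => pauliString fun q => p q.1) = pauliString p := by
  ext x y
  exact prod_cells hB fun q => pauliMatrix (p q) (x q) (y q)

lemma ofReal_pauliTransfer_eq_trace (U : QubitOp Q) (p' p : Q → Fin 4) :
    (pauliTransfer U p' p : ℂ) =
      (pauliString p' * (Uᴴ * pauliString p * U)).trace / 2 ^ Fintype.card Q := by
  rw [pauliTransfer, pauliCoeff]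
  push_cast
  rw [trace_im_of_isHermitian_mul (pauliString_isHermitian p') (conjTranspose_heisenberg U p)]

/-- Pauli strings are product operators, so the traces defining the entries factorize over the
cells. -/
lemma pauliTransfer_cellTensor [DecidableEq κ] (hB : ∀ q, ∃! c, q ∈ B c)
    (V : ∀ c, QubitOp {q // q ∈ B c}) (p' p : Q → Fin 4) :
    pauliTransfer (cellTensor B V) p' p =
      ∏ c, pauliTransfer (V c) (fun q => p' q.1) (fun q => p q.1) := by
  apply Complex.ofReal_injective
  push_cast
  simp only [ofReal_pauliTransfer_eq_trace]
  rw [Finset.prod_div_distrib, ← trace_cellTensor hB, conjTranspose_cellTensor,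
    ← cellTensor_pauliString hB p', ← cellTensor_pauliString hB p, cellTensor_mul hB,
    cellTensor_mul hB, cellTensor_mul hB]
  congr 1
  have := prod_cells hB fun _ => (2 : ℂ)
  simpa using this.symm

end CellTensor

/-! ### Path expansion of the circuit -/

/-- The path expansion of a matrix product: sum over all intermediate indices. The left vector is
general so that the first matrix can be absorbed into it in the induction. -/
lemma sum_mul_prod_ofFn_mul {α R : Type*} [Fintype α] [DecidableEq α] [CommSemiring R] {L : ℕ}
    (M : Fin L → Matrix α α R) (a b : α → R) :
    ∑ i, ∑ j, a i * (List.ofFn M).prod i j * b j =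
      ∑ p : Fin (L + 1) → α,
        a (p 0) * (∏ l, M l (p l.castSucc) (p l.succ)) * b (p (Fin.last L)) := by
  induction L generalizing a with
  | zero =>
    rw [← (Equiv.funUnique (Fin 1) α).symm.sum_comp]
    simp [Matrix.one_apply]
  | succ L ih =>
    have h := ih (fun l => M l.succ) (fun k => ∑ i, a i * M 0 i k)
    calc _ = ∑ k, ∑ j, (∑ i, a i * M 0 i k) * (List.ofFn fun l => M l.succ).prod k j * b j := by
          simp only [List.ofFn_succ, List.prod_cons, Matrix.mul_apply, Finset.mul_sum,
            Finset.sum_mul]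
          rw [Finset.sum_comm_cycle]
          refine Finset.sum_congr rfl fun k _ => ?_
          rw [Finset.sum_comm]
          simp only [mul_assoc]
      _ = _ := by
          have e := fun F : (Fin (L + 1 + 1) → α) → R =>
            (Fin.consEquiv (n := L + 1) fun _ => α).sum_comp F
          rw [h, ← e, Fintype.sum_prod_type, Finset.sum_comm]
          refine Finset.sum_congr rfl fun p _ => ?_
          rw [Finset.sum_mul, Finset.sum_mul]
          refine Finset.sum_congr rfl fun i _ => ?_
          simp only [Fin.consEquiv_apply, Fin.prod_univ_succ, Fin.cons_zero, Fin.castSucc_zero,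
            Fin.cons_succ, ← Fin.succ_last, ← Fin.succ_castSucc]
          ring

section Circuit

variable {Q : Type*} [Fintype Q] [DecidableEq Q]

lemma pauliTransfer_reverse_prod (l : List (QubitOp Q)) :
    pauliTransfer l.reverse.prod = (l.map pauliTransfer).prod := by
  induction l with
  | nil => simp [pauliTransfer_one]
  | cons U l ih => simp [pauliTransfer_mul, ih]

/-- The expectation value of a Pauli string. -/
noncomputable def pauliExpectation (ρ : QubitOp Q) (p : Q → Fin 4) : ℝ :=
  (pauliString p * ρ).trace.re

lemma trace_heisenberg {H : QubitOp Q} (hH : Hᴴ = H) (ρ U : QubitOp Q) :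
    (H * U * ρ * Uᴴ).trace.re =
      ∑ p', ∑ p, pauliExpectation ρ p' * pauliTransfer U p' p * pauliCoeff H p := by
  have h1 : (H * U * ρ * Uᴴ).trace = (Uᴴ * H * U * ρ).trace := by
    rw [Matrix.trace_mul_comm]
    simp only [Matrix.mul_assoc]
  rw [h1]
  conv_lhs => rw [← sum_pauliCoeff_smul hH]
  simp only [Finset.mul_sum, Finset.sum_mul, Matrix.mul_smul, Matrix.smul_mul,
    ← sum_pauliTransfer_smul U, Finset.smul_sum, smul_smul, Matrix.trace_sum, Matrix.trace_smul,
    Complex.re_sum, smul_eq_mul, ← Complex.ofReal_mul, Complex.re_ofReal_mul]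
  rw [Finset.sum_comm]
  refine Finset.sum_congr rfl fun p' _ => Finset.sum_congr rfl fun p _ => ?_
  rw [pauliExpectation]
  ring

namespace AlternatingLayout

variable {m L : ℕ} (Λ : AlternatingLayout Q m L)

lemma mem_layerBlocks_eq {l : Fin L} {S : Finset Q} (hS : S ∈ Λ.layerBlocks l) {q : Q}
    (hq : q ∈ S) : S = Finset.univ.filter fun q' => Λ.window l q' = Λ.window l q := by
  simp only [layerBlocks, Finset.mem_filter, Finset.mem_image, Finset.mem_univ, true_and] at hS
  obtain ⟨⟨r, rfl⟩, -⟩ := hS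
  simp only [Finset.mem_filter, Finset.mem_univ, true_and] at hq
  rw [hq]

lemma layerBlocks_eq_of_mem {l : Fin L} {S S' : Finset Q} (hS : S ∈ Λ.layerBlocks l)
    (hS' : S' ∈ Λ.layerBlocks l) {q : Q} (hq : q ∈ S) (hq' : q ∈ S') : S = S' := by
  rw [Λ.mem_layerBlocks_eq hS hq, ← Λ.mem_layerBlocks_eq hS' hq']

/-- The cells of a layer: its blocks and the set of the qubits outside of all blocks. -/
def layerCell (l : Fin L) : Option {S // S ∈ Λ.layerBlocks l} → Finset Q
  | none => Finset.univ.filter fun q => ∀ S ∈ Λ.layerBlocks l, q ∉ S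
  | some S => S.1

/-- The cell `none` collects the idle qubits, so that the cells form a partition even when
incomplete windows carry no block. -/
lemma existsUnique_mem_layerCell (l : Fin L) (q : Q) : ∃! c, q ∈ Λ.layerCell l c := by
  by_cases h : ∃ S ∈ Λ.layerBlocks l, q ∈ S
  · obtain ⟨S, hS, hq⟩ := h
    refine ⟨some ⟨S, hS⟩, hq, ?_⟩
    rintro (_ | ⟨S', hS'⟩) h
    · exact absurd hq ((Finset.mem_filter.mp h).2 S hS)
    · simpa using Λ.layerBlocks_eq_of_mem hS' hS h hq
  · push Not at h
    refine ⟨none, by simpa [layerCell] using h, ?_⟩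
    rintro (_ | ⟨S', hS'⟩) h'
    · rfl
    · exact absurd h' (h S' hS')

/-- The operators of a layer on its cells. -/
noncomputable def cellOp (W : (b : Λ.Block) → Λ.BlockUnitary b) (l : Fin L) :
    (c : Option {S // S ∈ Λ.layerBlocks l}) → QubitOp {q // q ∈ Λ.layerCell l c}
  | none => 1
  | some S => (W ⟨(l, S.1), S.2⟩).1

lemma layerOp_eq_cellTensor (W : (b : Λ.Block) → Λ.BlockUnitary b) (l : Fin L) :
    Λ.layerOp W l = cellTensor (Λ.layerCell l) (Λ.cellOp W l) := by
  ext x y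
  rw [layerOp, cellTensor, Fintype.prod_option, mul_comm]
  congr 1
  change _ = (1 : QubitOp {q // q ∈ Λ.layerCell l none}) _ _
  rw [Matrix.one_apply]
  refine if_congr ?_ rfl rfl
  simp [funext_iff, layerCell]

open Classical in
lemma pauliTransfer_layerOp (W : (b : Λ.Block) → Λ.BlockUnitary b) (l : Fin L)
    (p' p : Q → Fin 4) :
    pauliTransfer (Λ.layerOp W l) p' p =
      (if ∀ q, (∀ S ∈ Λ.layerBlocks l, q ∉ S) → p' q = p q then 1 else 0) *
      ∏ S : {S // S ∈ Λ.layerBlocks l}, pauliTransfer (W ⟨(l, S.1), S.2⟩).1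
        (fun q => p' q.1) (fun q => p q.1) := by
  rw [layerOp_eq_cellTensor, pauliTransfer_cellTensor (Λ.existsUnique_mem_layerCell l),
    Fintype.prod_option]
  congr 1
  change pauliTransfer (1 : QubitOp {q // q ∈ Λ.layerCell l none}) _ _ = _
  rw [pauliTransfer_one, Matrix.one_apply]
  refine if_congr ?_ rfl rfl
  simp [funext_iff, layerCell]

/-- A path of Pauli strings through the circuit is consistent if each layer leaves alone the
qubits which lie in none of its blocks. -/
def Consistent (p : Fin (L + 1) → Q → Fin 4) : Prop :=
  ∀ l : Fin L, ∀ q, (∀ S ∈ Λ.layerBlocks l, q ∉ S) → p l.castSucc q = p l.succ q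

/-- The Pauli string on the qubits of the block `b` just before the block is applied. -/
def pathIn (p : Fin (L + 1) → Q → Fin 4) (b : Λ.Block) : {q // q ∈ b.1.2} → Fin 4 :=
  fun q => p b.1.1.castSucc q.1

/-- The Pauli string on the qubits of the block `b` just after the block is applied. -/
def pathOut (p : Fin (L + 1) → Q → Fin 4) (b : Λ.Block) : {q // q ∈ b.1.2} → Fin 4 :=
  fun q => p b.1.1.succ q.1

lemma prod_blocks {M : Type*} [CommMonoid M] (f : Λ.Block → M) :
    ∏ l, ∏ S : {S // S ∈ Λ.layerBlocks l}, f ⟨(l, S.1), S.2⟩ = ∏ b, f b := by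
  rw [← Fintype.prod_sigma']
  exact Fintype.prod_equiv
    { toFun := fun x => (⟨(x.1, x.2.1), x.2.2⟩ : Λ.Block)
      invFun := fun b => ⟨b.1.1, ⟨b.1.2, b.2⟩⟩
      left_inv := fun _ => rfl
      right_inv := fun _ => rfl } _ _ fun _ => rfl

open Classical in
/-- The part of the weight of a path which does not depend on the blocks. -/
noncomputable def pathCoeff (H ρ : QubitOp Q) (p : Fin (L + 1) → Q → Fin 4) : ℝ :=
  if Λ.Consistent p then pauliExpectation ρ (p 0) * pauliCoeff H (p (Fin.last L)) else 0

lemma trace_circuitOp {H : QubitOp Q} (hH : Hᴴ = H) (ρ : QubitOp Q)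
    (W : (b : Λ.Block) → Λ.BlockUnitary b) :
    (H * Λ.circuitOp W * ρ * (Λ.circuitOp W)ᴴ).trace.re =
      ∑ p, Λ.pathCoeff H ρ p *
        ∏ b, pauliTransfer (W b).1 (Λ.pathIn p b) (Λ.pathOut p b) := by
  classical
  rw [trace_heisenberg hH, circuitOp, pauliTransfer_reverse_prod, List.map_ofFn,
    sum_mul_prod_ofFn_mul]
  refine Finset.sum_congr rfl fun p _ => ?_
  simp only [Function.comp_apply, pauliTransfer_layerOp, Finset.prod_mul_distrib]
  have e : ∏ l, ∏ S : {S // S ∈ Λ.layerBlocks l}, pauliTransfer (W ⟨(l, S.1), S.2⟩).1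
      (fun q => p l.castSucc q.1) (fun q => p l.succ q.1) =
      ∏ b, pauliTransfer (W b).1 (Λ.pathIn p b) (Λ.pathOut p b) :=
    Λ.prod_blocks fun b => pauliTransfer (W b).1 (Λ.pathIn p b) (Λ.pathOut p b)
  rw [e, Finset.prod_ite_zero, pathCoeff]
  simp only [Finset.mem_univ, true_implies, Finset.prod_const_one]
  unfold Consistent
  split_ifs <;> ring

end AlternatingLayout

end Circuit

/-! ### Expansion of the gradient and its second moment -/

lemma integral_mul_prod_of_indep {Ω ι : Type*} [MeasurableSpace Ω] [Fintype ι] {E : ι → Type*}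
    [∀ i, MeasurableSpace (E i)] {μ : Measure Ω} {X : Ω → ℝ} {Y : ∀ i, Ω → E i}
    (hX : Measurable X) (hY : ∀ i, Measurable (Y i)) (hXY : IndepFun X (fun θ i => Y i θ) μ)
    (hind : iIndepFun Y μ) {g : ℝ → ℝ} (hg : Measurable g) {f : ∀ i, E i → ℝ}
    (hf : ∀ i, Measurable (f i)) :
    ∫ θ, g (X θ) * ∏ i, f i (Y i θ) ∂μ = (∫ θ, g (X θ) ∂μ) * ∏ i, ∫ y, f i y ∂(μ.map (Y i)) := by
  have hm : Measurable fun z : (i : ι) → E i => ∏ i, f i (z i) :=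
    Finset.measurable_fun_prod _ fun i _ => (hf i).comp (measurable_pi_apply i)
  have h1 := hXY.integral_fun_comp_mul_comp (𝕜 := ℝ) (f := g) (g := fun z => ∏ i, f i (z i))
    hX.aemeasurable (measurable_pi_lambda _ hY).aemeasurable hg.aestronglyMeasurable
    hm.aestronglyMeasurable
  rw [h1, hind.integral_fun_prod_comp (fun i => (hY i).aemeasurable)
    fun i => (hf i).aestronglyMeasurable]
  simp only [fun i => integral_map (hY i).aemeasurable (hf i).aestronglyMeasurable (μ := μ)]

namespace AlternatingLayout

variable {Q : Type*} [Fintype Q] [DecidableEq Q] {m L : ℕ} (Λ : AlternatingLayout Q m L)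

/-- A path of Pauli strings through the circuit, together with the Pauli strings before and after
the differentiated gate in the block `b₀`. -/
abbrev GradPath (b₀ : Λ.Block) :=
  (Fin (L + 1) → Q → Fin 4) × ({q // q ∈ b₀.1.2} → Fin 4) × ({q // q ∈ b₀.1.2} → Fin 4)

variable {Λ}

/-- The Pauli strings of a path just before each of the random unitaries. -/
def factorIn {b₀ : Λ.Block} (w : Λ.GradPath b₀) :
    (x : Option Λ.Block) → {q // q ∈ (x.getD b₀).1.2} → Fin 4
  | none => Λ.pathIn w.1 b₀
  | some b => Function.update (Λ.pathIn w.1) b₀ w.2.2 b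

/-- The Pauli strings of a path just after each of the random unitaries. -/
def factorOut {b₀ : Λ.Block} (w : Λ.GradPath b₀) :
    (x : Option Λ.Block) → {q // q ∈ (x.getD b₀).1.2} → Fin 4
  | none => w.2.1
  | some b => Λ.pathOut w.1 b

/-- At a block both the incoming and the outgoing strings are prescribed, and in a layer where a
qubit is idle consistency carries its value across. Agreement at one time is thus equivalent to
agreement at any other, and covering supplies one time at which each qubit is known to agree. -/
lemma gradPath_ext (hΛ : Λ.Covers) {b₀ : Λ.Block} {w w' : Λ.GradPath b₀}
    (hw : Λ.Consistent w.1) (hw' : Λ.Consistent w'.1)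
    (hin : ∀ x, factorIn w x = factorIn w' x) (hout : ∀ x, factorOut w x = factorOut w' x) :
    w = w' := by
  have hin' : ∀ b, Λ.pathIn w.1 b = Λ.pathIn w'.1 b := by
    intro b
    by_cases hb : b = b₀
    · subst hb; exact hin none
    · simpa [factorIn, hb] using hin (some b)
  have hstep : ∀ (l : Fin L) (q : Q),
      w.1 l.castSucc q = w'.1 l.castSucc q ↔ w.1 l.succ q = w'.1 l.succ q := by
    intro l q
    by_cases h : ∀ S ∈ Λ.layerBlocks l, q ∉ S
    · rw [hw l q h, hw' l q h]
    · push Not at h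
      obtain ⟨S, hS, hq⟩ := h
      have h1 : w.1 l.castSucc q = w'.1 l.castSucc q :=
        congr_fun (hin' ⟨(l, S), hS⟩) ⟨q, hq⟩
      have h2 : w.1 l.succ q = w'.1 l.succ q := congr_fun (hout (some ⟨(l, S), hS⟩)) ⟨q, hq⟩
      exact ⟨fun _ => h2, fun _ => h1⟩
  have hpath : w.1 = w'.1 := by
    funext i q
    obtain ⟨b, hb⟩ := hΛ q
    -- Transport agreement at every time to time 0, and from there to the covering block.
    have hz : ∀ i : Fin (L + 1), w.1 i q = w'.1 i q ↔ w.1 0 q = w'.1 0 q := by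
      intro i
      induction i using Fin.induction with
      | zero => rfl
      | succ l ih => rw [← hstep l q, ih]
    rw [hz, ← hz b.1.1.castSucc]
    exact congr_fun (hin' b) ⟨q, hb⟩
  refine Prod.ext hpath (Prod.ext (hout none) ?_)
  simpa [factorIn] using hin (some b₀)

variable {d : ℕ} {W : (b : Λ.Block) → (Fin d → ℝ) → Λ.BlockUnitary b} {μ : Measure (Fin d → ℝ)}
  {ν : Fin d} {b₀ : Λ.Block} {F : QubitOp {q // q ∈ b₀.1.2}}
  {A B : (Fin d → ℝ) → Λ.BlockUnitary b₀}

/-- The product of the entries of the Pauli transfer matrices along a path. -/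
noncomputable def factorProd (W : (b : Λ.Block) → (Fin d → ℝ) → Λ.BlockUnitary b)
    (A B : (Fin d → ℝ) → Λ.BlockUnitary b₀) (w : Λ.GradPath b₀) (θ : Fin d → ℝ) : ℝ :=
  ∏ x, pauliTransfer (Λ.factors W b₀ A B x θ).1 (factorIn w x) (factorOut w x)

lemma factorProd_eq (w : Λ.GradPath b₀) (θ : Fin d → ℝ) :
    factorProd W A B w θ = pauliTransfer (B θ).1 (Λ.pathIn w.1 b₀) w.2.1 *
      (pauliTransfer (A θ).1 w.2.2 (Λ.pathOut w.1 b₀) *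
        ∏ b ∈ Finset.univ.erase b₀,
          pauliTransfer (W b θ).1 (Λ.pathIn w.1 b) (Λ.pathOut w.1 b)) := by
  have h₀ : pauliTransfer (Λ.factors W b₀ A B (some b₀) θ).1 (factorIn w (some b₀))
      (factorOut w (some b₀)) = pauliTransfer (A θ).1 w.2.2 (Λ.pathOut w.1 b₀) := by
    simp only [factors, factorIn, factorOut, Function.update_self]
  have hne : ∀ b ∈ Finset.univ.erase b₀, pauliTransfer (Λ.factors W b₀ A B (some b) θ).1
      (factorIn w (some b)) (factorOut w (some b)) =
      pauliTransfer (W b θ).1 (Λ.pathIn w.1 b) (Λ.pathOut w.1 b) := by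
    intro b hb
    simp only [factors, factorIn, factorOut, Function.update_of_ne (Finset.ne_of_mem_erase hb)]
  rw [factorProd, Fintype.prod_option, ← Finset.mul_prod_erase _ _ (Finset.mem_univ b₀), h₀,
    Finset.prod_congr rfl hne]
  rfl

/-- Along the line in direction `ν` only the rotation gate moves, so differentiating the path sum
replaces its transfer matrix by the derivative. -/
theorem IsDesignAnsatz.partialDeriv_costFunction (h : Λ.IsDesignAnsatz W μ ν b₀ F A B)
    {H : QubitOp Q} (hH : Hᴴ = H) (ρ : QubitOp Q) (θ : Fin d → ℝ) :
    partialDeriv (costFunction H ρ fun θ => Λ.circuitOp fun b => W b θ) ν θ =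
      ∑ w : Λ.GradPath b₀, Λ.pathCoeff H ρ w.1 *
        (rotationDerivTransfer F (θ ν) w.2.1 w.2.2 * factorProd W A B w θ) := by
  have hW : ∀ b, b ≠ b₀ → ∀ t, W b (Function.update θ ν t) = W b θ := by
    intro b hb t
    simpa [factors, hb] using h.factors_update (some b) θ t
  have hW₀ : ∀ t, (W b₀ (Function.update θ ν t)).1 = (A θ).1 * rotationGate F t * (B θ).1 := by
    intro t
    have hA := h.factors_update (some b₀) θ t
    have hB := h.factors_update none θ t
    simp only [factors, Function.update_self] at hA hB
    rw [h.split, hA, hB, Function.update_self, rotationGate]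
  have hC : ∀ t, costFunction H ρ (fun θ => Λ.circuitOp fun b => W b θ) (Function.update θ ν t) =
      ∑ p, Λ.pathCoeff H ρ p *
        ((∑ u', ∑ u, pauliTransfer (B θ).1 (Λ.pathIn p b₀) u' *
          (pauliTransfer (rotationGate F t) u' u * pauliTransfer (A θ).1 u (Λ.pathOut p b₀))) *
          ∏ b ∈ Finset.univ.erase b₀,
            pauliTransfer (W b θ).1 (Λ.pathIn p b) (Λ.pathOut p b)) := by
    intro t
    rw [costFunction, Λ.trace_circuitOp hH]
    refine Finset.sum_congr rfl fun p _ => ?_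
    have hne : ∀ b ∈ Finset.univ.erase b₀, pauliTransfer (W b (Function.update θ ν t)).1
        (Λ.pathIn p b) (Λ.pathOut p b) =
        pauliTransfer (W b θ).1 (Λ.pathIn p b) (Λ.pathOut p b) := by
      intro b hb
      rw [hW b (Finset.ne_of_mem_erase hb)]
    rw [← Finset.mul_prod_erase _ _ (Finset.mem_univ b₀), hW₀, pauliTransfer_mul,
      pauliTransfer_mul, Finset.prod_congr rfl hne]
    simp only [Matrix.mul_apply, Finset.mul_sum]
  have hderiv : HasDerivAt (fun t => costFunction H ρ (fun θ => Λ.circuitOp fun b => W b θ)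
      (Function.update θ ν t))
      (∑ p, Λ.pathCoeff H ρ p *
        ((∑ u', ∑ u, pauliTransfer (B θ).1 (Λ.pathIn p b₀) u' *
          (rotationDerivTransfer F (θ ν) u' u * pauliTransfer (A θ).1 u (Λ.pathOut p b₀))) *
          ∏ b ∈ Finset.univ.erase b₀,
            pauliTransfer (W b θ).1 (Λ.pathIn p b) (Λ.pathOut p b))) (θ ν) := by
    simp only [hC]
    refine HasDerivAt.fun_sum fun p _ => HasDerivAt.const_mul _ (HasDerivAt.mul_const ?_ _)
    refine HasDerivAt.fun_sum fun u' _ => HasDerivAt.fun_sum fun u _ => ?_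
    exact ((hasDerivAt_pauliTransfer_rotationGate h.isHermitian _ u' u).mul_const _).const_mul _
  rw [partialDeriv, hderiv.deriv, Fintype.sum_prod_type]
  refine Finset.sum_congr rfl fun p _ => ?_
  rw [Fintype.sum_prod_type, Finset.sum_mul, Finset.mul_sum]
  refine Finset.sum_congr rfl fun u' _ => ?_
  rw [Finset.sum_mul, Finset.mul_sum]
  refine Finset.sum_congr rfl fun u _ => ?_
  rw [factorProd_eq]
  ring

namespace IsDesignAnsatz

variable (h : Λ.IsDesignAnsatz W μ ν b₀ F A B)
include h

lemma measurable_factorProd (w : Λ.GradPath b₀) : Measurable (factorProd W A B w) :=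
  Finset.measurable_fun_prod _ fun x _ => (measurable_pauliTransfer _ _).comp (h.measurable x)

omit h in
lemma abs_factorProd_le (w : Λ.GradPath b₀) (θ : Fin d → ℝ) : |factorProd W A B w θ| ≤ 1 := by
  rw [factorProd, Finset.abs_prod]
  exact Finset.prod_le_one (fun _ _ => abs_nonneg _) fun x _ =>
    abs_pauliTransfer_le_one (Λ.factors W b₀ A B x θ).2 _ _

omit h in
lemma measurable_rotationDerivTransfer (u' u : {q // q ∈ b₀.1.2} → Fin 4) :
    Measurable fun θ : Fin d → ℝ => rotationDerivTransfer F (θ ν) u' u :=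
  (continuous_rotationDerivTransfer F u' u).measurable.comp (measurable_pi_apply ν)

/-- Averages over the circuit factorize. -/
lemma integral_mul_prod {g : ℝ → ℝ} (hg : Measurable g)
    {f : (x : Option Λ.Block) → Λ.BlockUnitary (x.getD b₀) → ℝ} (hf : ∀ x, Measurable (f x)) :
    ∫ θ, g (θ ν) * ∏ x, f x (Λ.factors W b₀ A B x θ) ∂μ =
      (∫ θ, g (θ ν) ∂μ) * ∏ x, ∫ U, f x U ∂(μ.map (Λ.factors W b₀ A B x)) :=
  integral_mul_prod_of_indep (measurable_pi_apply ν) h.measurable h.indep_angle h.indep hg hf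

/-- The string just before the gate may be taken nontrivial, since otherwise the derivative
vanishes. Then the factor of the part `B` has mean zero. -/
lemma integral_rotationDerivTransfer_mul_factorProd (w : Λ.GradPath b₀) :
    ∫ θ, rotationDerivTransfer F (θ ν) w.2.1 w.2.2 * factorProd W A B w θ ∂μ = 0 := by
  by_cases hw : w.2.1 = 0
  · simp [hw, rotationDerivTransfer_zero_left h.isHermitian]
  · unfold factorProd
    rw [h.integral_mul_prod (continuous_rotationDerivTransfer F _ _).measurable
      fun x => measurable_pauliTransfer (factorIn w x) (factorOut w x)]
    rw [Finset.prod_eq_zero (Finset.mem_univ none), mul_zero]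
    exact (h.design none).integral_pauliTransfer hw _

/-- Independence splits the average into one second moment per random unitary. Two different paths
differ at the input or output of some factor, and the second moment of that factor is zero. -/
lemma integral_mul_mul (hΛ : Λ.Covers) (w w' : Λ.GradPath b₀) (hw : Λ.Consistent w.1)
    (hw' : Λ.Consistent w'.1) :
    ∫ θ, (rotationDerivTransfer F (θ ν) w.2.1 w.2.2 * factorProd W A B w θ) *
      (rotationDerivTransfer F (θ ν) w'.2.1 w'.2.2 * factorProd W A B w' θ) ∂μ =
      if w = w' then (∫ θ, rotationDerivTransfer F (θ ν) w.2.1 w.2.2 ^ 2 ∂μ) *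
        ∏ x, twirlWeight (factorIn w x) (factorOut w x) else 0 := by
  have h1 : ∀ θ, (rotationDerivTransfer F (θ ν) w.2.1 w.2.2 * factorProd W A B w θ) *
      (rotationDerivTransfer F (θ ν) w'.2.1 w'.2.2 * factorProd W A B w' θ) =
      (rotationDerivTransfer F (θ ν) w.2.1 w.2.2 * rotationDerivTransfer F (θ ν) w'.2.1 w'.2.2) *
      ∏ x, (pauliTransfer (Λ.factors W b₀ A B x θ).1 (factorIn w x) (factorOut w x) *
        pauliTransfer (Λ.factors W b₀ A B x θ).1 (factorIn w' x) (factorOut w' x)) := by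
    intro θ
    rw [Finset.prod_mul_distrib, factorProd, factorProd]
    ring
  simp only [h1]
  rw [h.integral_mul_prod (g := fun t => rotationDerivTransfer F t w.2.1 w.2.2 *
      rotationDerivTransfer F t w'.2.1 w'.2.2) ((continuous_rotationDerivTransfer F _ _).mul
      (continuous_rotationDerivTransfer F _ _)).measurable
    (f := fun x U => pauliTransfer U.1 (factorIn w x) (factorOut w x) *
      pauliTransfer U.1 (factorIn w' x) (factorOut w' x))
    fun x => (measurable_pauliTransfer _ _).mul (measurable_pauliTransfer _ _)]
  simp only [fun x => (h.design x).integral_pauliTransfer_mul]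
  split_ifs with hww
  · subst hww
    simp [sq]
  · have : ∃ x, ¬ (factorIn w x = factorIn w' x ∧ factorOut w x = factorOut w' x) := by
      by_contra hcon
      push Not at hcon
      exact hww (gradPath_ext hΛ hw hw' (fun x => (hcon x).1) fun x => (hcon x).2)
    obtain ⟨x, hx⟩ := this
    rw [Finset.prod_eq_zero (Finset.mem_univ x) (if_neg hx), mul_zero]

variable [IsProbabilityMeasure μ]

lemma integrable_mul_mul (w w' : Λ.GradPath b₀) :
    Integrable (fun θ => (rotationDerivTransfer F (θ ν) w.2.1 w.2.2 * factorProd W A B w θ) *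
      (rotationDerivTransfer F (θ ν) w'.2.1 w'.2.2 * factorProd W A B w' θ)) μ := by
  have hb : ∀ (v : Λ.GradPath b₀) θ, |rotationDerivTransfer F (θ ν) v.2.1 v.2.2 *
      factorProd W A B v θ| ≤ 2 ^ Fintype.card {q // q ∈ b₀.1.2} := by
    intro v θ
    rw [abs_mul]
    exact (mul_le_mul (abs_rotationDerivTransfer_le h.isHermitian h.involution h.traceless _ _ _)
      (abs_factorProd_le v θ) (abs_nonneg _) (by positivity)).trans_eq (mul_one _)
  have hm : ∀ v : Λ.GradPath b₀, Measurable fun θ => rotationDerivTransfer F (θ ν) v.2.1 v.2.2 *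
      factorProd W A B v θ := fun v =>
    (measurable_rotationDerivTransfer _ _).mul (h.measurable_factorProd v)
  refine Integrable.of_bound ((hm w).mul (hm w')).aestronglyMeasurable
    (2 ^ Fintype.card {q // q ∈ b₀.1.2} * 2 ^ Fintype.card {q // q ∈ b₀.1.2})
    (ae_of_all _ fun θ => ?_)
  rw [Real.norm_eq_abs, abs_mul]
  exact mul_le_mul (hb w θ) (hb w' θ) (abs_nonneg _) (by positivity)

lemma integrable_rotationDerivTransfer_mul_factorProd (w : Λ.GradPath b₀) :
    Integrable (fun θ => rotationDerivTransfer F (θ ν) w.2.1 w.2.2 * factorProd W A B w θ) μ := by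
  refine Integrable.of_bound ((measurable_rotationDerivTransfer _ _).mul
    (h.measurable_factorProd w)).aestronglyMeasurable (2 ^ Fintype.card {q // q ∈ b₀.1.2})
    (ae_of_all _ fun θ => ?_)
  rw [Real.norm_eq_abs, abs_mul]
  exact (mul_le_mul (abs_rotationDerivTransfer_le h.isHermitian h.involution h.traceless _ _ _)
      (abs_factorProd_le w θ) (abs_nonneg _) (by positivity)).trans_eq (mul_one _)

/-- The variance of the gradient as a sum over paths of Pauli strings. -/
theorem variance_partialDeriv (hΛ : Λ.Covers) {H : QubitOp Q} (hH : Hᴴ = H) (ρ : QubitOp Q) :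
    variance (partialDeriv (costFunction H ρ fun θ => Λ.circuitOp fun b => W b θ) ν) μ =
      ∑ w : Λ.GradPath b₀, Λ.pathCoeff H ρ w.1 ^ 2 *
        ((∫ θ, rotationDerivTransfer F (θ ν) w.2.1 w.2.2 ^ 2 ∂μ) *
          ∏ x, twirlWeight (factorIn w x) (factorOut w x)) := by
  have hfun := funext (h.partialDeriv_costFunction hH ρ)
  have hmean : ∫ θ, partialDeriv (costFunction H ρ fun θ => Λ.circuitOp fun b => W b θ) ν θ ∂μ
      = 0 := by
    simp only [hfun]
    rw [integral_finsetSum _ fun w _ =>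
      (h.integrable_rotationDerivTransfer_mul_factorProd w).const_mul _]
    simp only [integral_const_mul, h.integral_rotationDerivTransfer_mul_factorProd, mul_zero,
      Finset.sum_const_zero]
  have hmeas : Measurable (partialDeriv (costFunction H ρ fun θ =>
      Λ.circuitOp fun b => W b θ) ν) := by
    rw [hfun]
    exact Finset.measurable_fun_sum _ fun w _ => ((measurable_rotationDerivTransfer _ _).mul
      (h.measurable_factorProd w)).const_mul _
  rw [variance_eq_integral hmeas.aemeasurable, hmean]
  simp only [sub_zero, hfun]
  have hsq : ∀ θ, (∑ w : Λ.GradPath b₀, Λ.pathCoeff H ρ w.1 *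
        (rotationDerivTransfer F (θ ν) w.2.1 w.2.2 * factorProd W A B w θ)) ^ 2 =
      ∑ w : Λ.GradPath b₀, ∑ w' : Λ.GradPath b₀, (Λ.pathCoeff H ρ w.1 * Λ.pathCoeff H ρ w'.1) *
        ((rotationDerivTransfer F (θ ν) w.2.1 w.2.2 * factorProd W A B w θ) *
        (rotationDerivTransfer F (θ ν) w'.2.1 w'.2.2 * factorProd W A B w' θ)) := by
    intro θ
    rw [sq, Finset.sum_mul_sum]
    exact Finset.sum_congr rfl fun w _ => Finset.sum_congr rfl fun w' _ => by ring
  simp only [hsq]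
  rw [integral_finsetSum _ fun w _ => integrable_finsetSum _ fun w' _ =>
    (h.integrable_mul_mul w w').const_mul _]
  refine Finset.sum_congr rfl fun w _ => ?_
  rw [integral_finsetSum _ fun w' _ => (h.integrable_mul_mul w w').const_mul _]
  simp only [integral_const_mul]
  rw [Finset.sum_eq_single w]
  · by_cases hw : Λ.Consistent w.1
    · rw [h.integral_mul_mul hΛ w w hw hw, if_pos rfl, sq]
    · simp [pathCoeff, hw]
  · intro w' _ hne
    by_cases hw : Λ.Consistent w.1
    · by_cases hw' : Λ.Consistent w'.1
      · rw [h.integral_mul_mul hΛ w w' hw hw', if_neg hne.symm, mul_zero]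
      · simp [pathCoeff, hw']
    · simp [pathCoeff, hw]
  · simp

/-- With `N = 4 ^ |Q|`, both designs spread nontrivial strings uniformly with weight `1 / (N - 1)`,
so only the total `N / 2` of the squared derivative entries matters. The result `(N / 2) / (N - 1) ^
2` is at least half of `1 / (N - 1)`, the weight of an undivided block. -/
lemma le_sum_integral_mul_twirlWeight (p' p : {q // q ∈ b₀.1.2} → Fin 4) (hp : p ≠ 0) :
    1 / 2 * twirlWeight p' p ≤ ∑ u', ∑ u,
      (∫ θ, rotationDerivTransfer F (θ ν) u' u ^ 2 ∂μ) * (twirlWeight p' u' * twirlWeight u p) := by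
  by_cases hp' : p' = 0
  · have : twirlWeight p' p = 0 := by simp [twirlWeight, hp, hp']
    rw [this, mul_zero]
    exact Finset.sum_nonneg fun u' _ => Finset.sum_nonneg fun u _ =>
      mul_nonneg (integral_nonneg fun θ => sq_nonneg _)
        (mul_nonneg (twirlWeight_nonneg _ _) (twirlWeight_nonneg _ _))
  set N : ℝ := (4 : ℝ) ^ Fintype.card {q // q ∈ b₀.1.2} with hN
  have hpos : 0 < N - 1 := card_pauli_sub_one_pos hp
  have h1 : ∀ u' u, (∫ θ, rotationDerivTransfer F (θ ν) u' u ^ 2 ∂μ) *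
      (twirlWeight p' u' * twirlWeight u p) =
      (∫ θ, rotationDerivTransfer F (θ ν) u' u ^ 2 ∂μ) * ((N - 1)⁻¹ * (N - 1)⁻¹) := by
    intro u' u
    -- The twirl weights differ from the uniform value only at trivial strings, where the derivative
    -- entry is zero anyway.
    by_cases hu' : u' = 0
    · simp [hu', rotationDerivTransfer_zero_left h.isHermitian]
    by_cases hu : u = 0
    · simp [hu, rotationDerivTransfer_zero_right]
    simp [twirlWeight, hp, hp', hu, hu', hN]
  have hint : ∀ u' u, Integrable (fun θ : Fin d → ℝ => rotationDerivTransfer F (θ ν) u' u ^ 2) μ := by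
    intro u' u
    refine Integrable.of_bound
      ((measurable_rotationDerivTransfer u' u).pow_const 2).aestronglyMeasurable
      ((2 ^ Fintype.card {q // q ∈ b₀.1.2}) ^ 2) (ae_of_all _ fun θ => ?_)
    rw [Real.norm_eq_abs, abs_pow]
    exact pow_le_pow_left₀ (abs_nonneg _)
      (abs_rotationDerivTransfer_le h.isHermitian h.involution h.traceless _ _ _) 2
  have h2 : ∑ u', ∑ u, ∫ θ, rotationDerivTransfer F (θ ν) u' u ^ 2 ∂μ = N / 2 := by
    rw [Finset.sum_comm]
    simp only [← integral_finsetSum _ fun u' (_ : u' ∈ Finset.univ) => hint u' _]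
    rw [← integral_finsetSum _ fun u _ => integrable_finsetSum _ fun u' _ => hint u' u]
    simp only [sum_rotationDerivTransfer_sq h.isHermitian h.involution h.traceless]
    simp [hN]
  simp only [h1, ← Finset.sum_mul, h2]
  have h3 : twirlWeight p' p = (N - 1)⁻¹ := by simp [twirlWeight, hp, hp', hN]
  rw [h3]
  have h4 : 1 ≤ N * (N - 1)⁻¹ := by
    rw [← div_eq_mul_inv, one_le_div hpos]; linarith
  have h5 : 0 < (N - 1)⁻¹ := inv_pos.mpr hpos
  nlinarith

open Classical in
/-- A lower bound for the variance of the gradient by a sum over the paths of Pauli strings which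
meet the block `b₀`. -/
theorem le_variance_partialDeriv (hΛ : Λ.Covers) {H : QubitOp Q} (hH : Hᴴ = H) (ρ : QubitOp Q) :
    ∑ p : Fin (L + 1) → Q → Fin 4, (if Λ.pathOut p b₀ ≠ 0 then Λ.pathCoeff H ρ p ^ 2 *
      (1 / 2 * ∏ b, twirlWeight (Λ.pathIn p b) (Λ.pathOut p b)) else 0) ≤
    variance (partialDeriv (costFunction H ρ fun θ => Λ.circuitOp fun b => W b θ) ν) μ := by
  rw [h.variance_partialDeriv hΛ hH, Fintype.sum_prod_type]
  refine Finset.sum_le_sum fun p _ => ?_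
  have hprod : ∀ u' u, ∏ x, twirlWeight (factorIn (b₀ := b₀) (p, u', u) x)
      (factorOut (b₀ := b₀) (p, u', u) x) =
      (twirlWeight (Λ.pathIn p b₀) u' * twirlWeight u (Λ.pathOut p b₀)) *
        ∏ b ∈ Finset.univ.erase b₀, twirlWeight (Λ.pathIn p b) (Λ.pathOut p b) := by
    intro u' u
    have h₀ : twirlWeight (factorIn (b₀ := b₀) (p, u', u) (some b₀))
        (factorOut (b₀ := b₀) (p, u', u) (some b₀)) = twirlWeight u (Λ.pathOut p b₀) := by
      simp only [factorIn, factorOut, Function.update_self]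
    have hne : ∀ b ∈ Finset.univ.erase b₀, twirlWeight (factorIn (b₀ := b₀) (p, u', u) (some b))
        (factorOut (b₀ := b₀) (p, u', u) (some b)) =
        twirlWeight (Λ.pathIn p b) (Λ.pathOut p b) := by
      intro b hb
      simp only [factorIn, factorOut, Function.update_of_ne (Finset.ne_of_mem_erase hb)]
    rw [Fintype.prod_option, ← Finset.mul_prod_erase _ _ (Finset.mem_univ b₀), h₀,
      Finset.prod_congr rfl hne, ← mul_assoc]
    rfl
  simp only [hprod]
  rw [Fintype.sum_prod_type]
  simp only [← Finset.mul_sum]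
  have hassoc : ∀ x y z : ℝ, x * (y * z) = x * y * z := fun x y z => (mul_assoc x y z).symm
  simp only [hassoc (∫ θ, _ ∂μ) _ (Finset.prod _ _), ← Finset.sum_mul]
  have hnn : 0 ≤ ∏ b ∈ Finset.univ.erase b₀, twirlWeight (Λ.pathIn p b) (Λ.pathOut p b) :=
    Finset.prod_nonneg fun b _ => twirlWeight_nonneg _ _
  split_ifs with hp
  · refine mul_le_mul_of_nonneg_left ?_ (sq_nonneg _)
    rw [← Finset.mul_prod_erase _ _ (Finset.mem_univ b₀), ← mul_assoc]
    exact mul_le_mul_of_nonneg_right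
      (h.le_sum_integral_mul_twirlWeight (Λ.pathIn p b₀) (Λ.pathOut p b₀) hp) hnn
  -- Paths that are trivial on the output of `b₀` are discarded; nonnegativity suffices.
  · refine mul_nonneg (sq_nonneg _) (mul_nonneg ?_ hnn)
    exact Finset.sum_nonneg fun u' _ => Finset.sum_nonneg fun u _ =>
      mul_nonneg (integral_nonneg fun θ => sq_nonneg _)
        (mul_nonneg (twirlWeight_nonneg _ _) (twirlWeight_nonneg _ _))

end IsDesignAnsatz

end AlternatingLayout

/-! ### Pauli coefficients of the gadget Hamiltonian -/

section PauliVec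

/-- The real linear combination of Pauli matrices with coefficients `v`. -/
def pauliVec (v : Fin 4 → ℝ) : Matrix (Fin 2) (Fin 2) ℂ := ∑ a, (v a : ℂ) • pauliMatrix a

lemma trace_pauliMatrix_mul_pauliVec (a : Fin 4) (v : Fin 4 → ℝ) :
    (pauliMatrix a * pauliVec v).trace = 2 * (v a : ℂ) := by
  simp [pauliVec, Finset.mul_sum, Matrix.trace_sum, Matrix.trace_smul,
    trace_pauliMatrix_mul, mul_comm]

lemma pauliVec_isHermitian (v : Fin 4 → ℝ) : (pauliVec v)ᴴ = pauliVec v := by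
  simp [pauliVec, Matrix.conjTranspose_sum, Matrix.conjTranspose_smul, pauliMatrix_isHermitian]

lemma pauliVec_single (a : Fin 4) : pauliVec (Pi.single a 1) = pauliMatrix a := by
  simp [pauliVec, Pi.single_apply, ite_smul]

variable {Q : Type*} [Fintype Q] [DecidableEq Q]

/-- The set of qubits on which a Pauli string acts nontrivially. -/
def pauliSupport (p : Q → Fin 4) : Finset Q := Finset.univ.filter fun q => p q ≠ 0

omit [DecidableEq Q] in
lemma mem_pauliSupport {p : Q → Fin 4} {q : Q} : q ∈ pauliSupport p ↔ p q ≠ 0 := by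
  simp [pauliSupport]

lemma pauliCoeff_qubitTensor (v : Q → Fin 4 → ℝ) (p : Q → Fin 4) :
    pauliCoeff (qubitTensor fun q => pauliVec (v q)) p = ∏ q, v q (p q) := by
  rw [pauliCoeff, pauliString, qubitTensor_mul, trace_qubitTensor]
  simp only [trace_pauliMatrix_mul_pauliVec, Finset.prod_mul_distrib, Finset.prod_const,
    Finset.card_univ]
  rw [div_eq_iff (by positivity), mul_comm]
  norm_cast

lemma pauliCoeff_smul (c : ℝ) (O : QubitOp Q) (p : Q → Fin 4) :
    pauliCoeff ((c : ℂ) • O) p = c * pauliCoeff O p := by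
  rw [pauliCoeff, Matrix.mul_smul, Matrix.trace_smul, smul_eq_mul, Complex.re_ofReal_mul,
    pauliCoeff, mul_div_assoc]

lemma pauliCoeff_add (A B : QubitOp Q) (p : Q → Fin 4) :
    pauliCoeff (A + B) p = pauliCoeff A p + pauliCoeff B p := (pauliCoeffLinear p).map_add A B

lemma pauliCoeff_sum {ι : Type*} (s : Finset ι) (A : ι → QubitOp Q) (p : Q → Fin 4) :
    pauliCoeff (∑ i ∈ s, A i) p = ∑ i ∈ s, pauliCoeff (A i) p :=
  map_sum (pauliCoeffLinear p) A s

lemma pauliCoeff_one {p : Q → Fin 4} (hp : p ≠ 0) : pauliCoeff 1 p = 0 := by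
  rw [pauliCoeff, ← pauliString_zero, trace_pauliString_mul, if_neg hp]
  simp

lemma onQubit_eq_qubitTensor (q : Q) (A : Matrix (Fin 2) (Fin 2) ℂ) :
    onQubit q A = qubitTensor fun q' => if q' = q then A else 1 := by
  ext x y
  rw [onQubit, qubitTensor, ← Finset.mul_prod_erase _ _ (Finset.mem_univ q), if_pos rfl]
  have : ∏ q' ∈ Finset.univ.erase q, (if q' = q then A else 1) (x q') (y q') =
      if ∀ q', q' ≠ q → x q' = y q' then 1 else 0 := by
    rw [Finset.prod_congr rfl (g := fun q' => if x q' = y q' then (1 : ℂ) else 0),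
      Finset.prod_ite_zero]
    · simp
    · intro q' hq'
      rw [if_neg (Finset.ne_of_mem_erase hq'), Matrix.one_apply]
  rw [this]
  split_ifs <;> simp

end PauliVec

namespace GadgetData

variable {n r k : ℕ} (G : GadgetData n r k)

/-- The Pauli coefficients of the single-qubit factors of a term of the gadget Hamiltonian. -/
noncomputable def termVec : G.Term → GadgetQubit n r k → Fin 4 → ℝ
  | Sum.inl (s, j), q => if q = Sum.inr (s, j) then Pi.single 3 1 else Pi.single 0 1
  | Sum.inr (s, j), q => if q = Sum.inl (G.site s j) then
      ![0, G.axis s j 0, G.axis s j 1, G.axis s j 2]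
    else if q = Sum.inr (s, j) ∨ q = Sum.inr (s, next j) then Pi.single 1 1 else Pi.single 0 1

/-- The operator of a term of the gadget Hamiltonian, without its coefficient. -/
noncomputable def termOp (T : G.Term) : QubitOp (GadgetQubit n r k) :=
  qubitTensor fun q => pauliVec (G.termVec T q)

lemma termOp_isHermitian (T : G.Term) : (G.termOp T)ᴴ = G.termOp T := by
  simp [termOp, conjTranspose_qubitTensor, pauliVec_isHermitian]

lemma termOp_inl (s : Fin r) (j : Fin k) :
    G.termOp (Sum.inl (s, j)) = onQubit (Sum.inr (s, j)) pauliZ := by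
  rw [onQubit_eq_qubitTensor, termOp]
  congr 1
  funext q
  simp only [termVec]
  split_ifs
  · exact pauliVec_single 3
  · exact pauliVec_single 0

lemma next_ne (hk : 2 ≤ k) (j : Fin k) : next j ≠ j := by
  intro h
  have h1 := congr_arg Fin.val h
  simp only [next] at h1
  rcases Nat.lt_or_ge ((j : ℕ) + 1) k with h2 | h2
  · rw [Nat.mod_eq_of_lt h2] at h1; omega
  · have h3 : (j : ℕ) + 1 = k := by omega
    rw [h3, Nat.mod_self] at h1; omega

lemma termOp_inr (hk : 2 ≤ k) (s : Fin r) (j : Fin k) :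
    G.termOp (Sum.inr (s, j)) = onQubit (Sum.inl (G.site s j)) (G.sigma s j) *
      onQubit (Sum.inr (s, j)) pauliX * onQubit (Sum.inr (s, next j)) pauliX := by
  simp only [onQubit_eq_qubitTensor, termOp, qubitTensor_mul]
  congr 1
  funext q
  have hX : pauliVec (Pi.single 1 1) = pauliX := pauliVec_single 1
  have h1 : pauliVec (Pi.single 0 1) = 1 := pauliVec_single 0
  have hσ : pauliVec ![0, G.axis s j 0, G.axis s j 1, G.axis s j 2] = G.sigma s j := by
    simp [pauliVec, sigma, Fin.sum_univ_four, pauliMatrix]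
  simp only [termVec]
  by_cases ha : q = Sum.inl (G.site s j)
  · subst ha
    simp [hσ]
  · by_cases hb : q = Sum.inr (s, j)
    · subst hb
      simp [hX, (next_ne hk j).symm]
    · by_cases hc : q = Sum.inr (s, next j)
      · subst hc
        simp [hX, next_ne hk j]
      · simp [ha, hb, hc, h1]

/-- The scalar part, `1/2` for each of the `r * k` auxiliary qubits, affects only the trivial string
and is split off. -/
lemma gadgetHamiltonian_eq (hk : 2 ≤ k) :
    G.gadgetHamiltonian = (((r * k / 2 : ℝ)) : ℂ) • 1 + ∑ T : G.Term, (G.coeff T : ℂ) • G.termOp T := by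
  rw [gadgetHamiltonian, Fintype.sum_sum_type, Fintype.sum_prod_type, Fintype.sum_prod_type,
    ← add_assoc]
  congr 1
  · simp only [hAux, coeff, termOp_inl, smul_sub, Finset.sum_sub_distrib]
    rw [sub_eq_add_neg]
    congr 1
    · simp only [Finset.sum_const, Finset.card_univ, Fintype.card_fin, ← Nat.cast_smul_eq_nsmul ℂ,
        smul_smul]
      congr 1
      push_cast
      ring
    · simp only [← Finset.sum_neg_distrib, ← neg_smul]
      push_cast
      rfl
  · simp only [perturbation, coeff, termOp_inr G hk, Finset.smul_sum, smul_smul]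
    push_cast
    rfl

lemma conjTranspose_gadgetHamiltonian (hk : 2 ≤ k) :
    G.gadgetHamiltonianᴴ = G.gadgetHamiltonian := by
  rw [gadgetHamiltonian_eq G hk]
  simp [Matrix.conjTranspose_add, Matrix.conjTranspose_sum, Matrix.conjTranspose_smul,
    termOp_isHermitian]

lemma pauliCoeff_gadgetHamiltonian (hk : 2 ≤ k) {p : GadgetQubit n r k → Fin 4} (hp : p ≠ 0) :
    pauliCoeff G.gadgetHamiltonian p = ∑ T : G.Term, G.coeff T * ∏ q, G.termVec T q (p q) := by
  rw [gadgetHamiltonian_eq G hk, pauliCoeff_add, pauliCoeff_smul, pauliCoeff_one hp,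
    pauliCoeff_sum, mul_zero, zero_add]
  simp only [pauliCoeff_smul, termOp, pauliCoeff_qubitTensor]

/-- On its support a term has only traceless factors, and elsewhere the identity. Every Pauli string
occurring in a term therefore has exactly the support of the term. -/
lemma termVec_ne_zero {T : G.Term} {q : GadgetQubit n r k} {a : Fin 4}
    (h : G.termVec T q a ≠ 0) : a ≠ 0 ↔ q ∈ G.support T := by
  rcases T with ⟨s, j⟩ | ⟨s, j⟩
  · simp only [termVec, support, Finset.mem_singleton] at h ⊢
    split_ifs at h with h1
    · simp only [h1, iff_true]; rintro rfl; simp at h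
    · simp only [h1, iff_false, not_not]
      by_contra h2
      exact h (Pi.single_eq_of_ne h2 _)
  · simp only [termVec, support, Finset.mem_singleton, Finset.mem_insert] at h ⊢
    split_ifs at h with h1 h2
    · simp only [h1, true_or, iff_true]; rintro rfl; simp at h
    · simp only [h2, or_true, iff_true]; rintro rfl; simp at h
    · simp only [h1, h2, or_self, iff_false, not_not]
      by_contra h2
      exact h (Pi.single_eq_of_ne h2 _)

lemma pauliSupport_eq_support {T : G.Term} {p : GadgetQubit n r k → Fin 4}
    (h : ∏ q, G.termVec T q (p q) ≠ 0) : pauliSupport p = G.support T := by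
  ext q
  rw [mem_pauliSupport]
  exact G.termVec_ne_zero (Finset.prod_ne_zero_iff.mp h q (Finset.mem_univ q))

/-- The presence of a target qubit distinguishes the two kinds of terms. For a perturbation term the
auxiliary qubits reveal the register `s`, and then the target qubit reveals `j`, as the sites of one
`s` are distinct. This argument also covers `k = 2`, where both terms of a register act on the same
auxiliary qubits. -/
lemma support_injective : Function.Injective G.support := by
  rintro (⟨s, j⟩ | ⟨s, j⟩) (⟨s', j'⟩ | ⟨s', j'⟩) h
  · simpa [support] using h
  · have h1 : Sum.inl (G.site s' j') ∈ G.support (Sum.inl (s, j)) := by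
      rw [h]; simp [support]
    simp [support] at h1
  · have h1 : Sum.inl (G.site s j) ∈ G.support (Sum.inl (s', j')) := by
      rw [← h]; simp [support]
    simp [support] at h1
  · have h1 : Sum.inl (G.site s j) ∈ G.support (Sum.inr (s', j')) := by
      rw [← h]; simp [support]
    have h2 : Sum.inr (s, j) ∈ G.support (Sum.inr (s', j')) := by
      rw [← h]; simp [support]
    simp only [support, Finset.mem_insert, Sum.inl.injEq, Finset.mem_singleton, reduceCtorEq,
      or_self, or_false, Sum.inr.injEq, Prod.mk.injEq, false_or] at h1 h2
    have hs : s = s' := by tauto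
    subst hs
    rw [G.site_injective s h1]

lemma card_support_le (T : G.Term) : (G.support T).card ≤ 3 := by
  rcases T with ⟨s, j⟩ | ⟨s, j⟩
  · simp [support]
  · exact Finset.card_le_three

lemma support_nonempty (T : G.Term) : (G.support T).Nonempty := by
  rcases T with ⟨s, j⟩ | ⟨s, j⟩ <;> simp [support]

lemma sum_termVec_sq (T : G.Term) (q : GadgetQubit n r k) : ∑ a, G.termVec T q a ^ 2 = 1 := by
  have h := G.axis_unit
  rcases T with ⟨s, j⟩ | ⟨s, j⟩
  · simp only [termVec]
    split_ifs <;> simp [Pi.single_apply]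
  · simp only [termVec]
    split_ifs
    · have := h s j
      rw [Fin.sum_univ_three] at this
      simpa [Fin.sum_univ_four] using this
    · simp [Pi.single_apply]
    · simp [Pi.single_apply]

/-- The Pauli coefficients of the gadget Hamiltonian on the support of a term. -/
lemma sum_pauliCoeff_gadgetHamiltonian_sq (hk : 2 ≤ k) (T : G.Term) :
    ∑ p, (if pauliSupport p = G.support T then pauliCoeff G.gadgetHamiltonian p ^ 2 else 0) =
      G.coeff T ^ 2 := by
  have h1 : ∀ p, (if pauliSupport p = G.support T then pauliCoeff G.gadgetHamiltonian p ^ 2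
      else 0) = G.coeff T ^ 2 * ∏ q, G.termVec T q (p q) ^ 2 := by
    intro p
    split_ifs with h
    · have hp : p ≠ 0 := by
        rintro rfl
        have := G.support_nonempty T
        rw [← h] at this
        simp [pauliSupport] at this
      -- Only the term `T` has this support, so no other term can interfere with the coefficient.
      rw [pauliCoeff_gadgetHamiltonian G hk hp, Finset.sum_eq_single T, mul_pow,
        Finset.prod_pow]
      · intro T' _ hT'
        by_contra h2
        exact hT' (G.support_injective
          ((G.pauliSupport_eq_support (right_ne_zero_of_mul h2)).symm.trans h))
      · simp
    · rw [Finset.prod_pow, not_not.mp (mt G.pauliSupport_eq_support h)]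
      simp
  simp only [h1, ← Finset.mul_sum]
  have h2 := Finset.prod_univ_sum (fun _ : GadgetQubit n r k => (Finset.univ : Finset (Fin 4)))
    (fun q a => G.termVec T q a ^ 2)
  rw [Fintype.piFinset_univ] at h2
  rw [← h2]
  simp [sum_termVec_sq]

end GadgetData

/-! ### Expectation values of Pauli strings in product states -/

/-- The expectation value of a Pauli matrix in the pure state `ψ`. -/
noncomputable def blochCoord (ψ : Fin 2 → ℂ) (a : Fin 4) : ℝ :=
  (pauliMatrix a * Matrix.vecMulVec ψ (star ψ)).trace.re

lemma blochCoord_zero {ψ : Fin 2 → ℂ} (hψ : ∑ i, ‖ψ i‖ ^ 2 = 1) : blochCoord ψ 0 = 1 := by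
  rw [Fin.sum_univ_two] at hψ
  rw [← hψ]
  simp [blochCoord, pauliMatrix, Matrix.trace, Matrix.vecMulVec_apply, Complex.mul_conj,
    Complex.normSq_eq_norm_sq]
  norm_cast

/-- The Bloch vector of a pure state has length 1, so one of its three coordinates has square at
least 1/3. -/
lemma exists_blochCoord_sq_ge {ψ : Fin 2 → ℂ} (hψ : ∑ i, ‖ψ i‖ ^ 2 = 1) :
    ∃ a, a ≠ 0 ∧ 1 / 3 ≤ blochCoord ψ a ^ 2 := by
  have hsum : blochCoord ψ 1 ^ 2 + blochCoord ψ 2 ^ 2 + blochCoord ψ 3 ^ 2 = 1 := by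
    rw [Fin.sum_univ_two, ← Complex.normSq_eq_norm_sq, ← Complex.normSq_eq_norm_sq,
      Complex.normSq_apply, Complex.normSq_apply] at hψ
    have h1 : blochCoord ψ 1 = 2 * ((ψ 0).re * (ψ 1).re + (ψ 0).im * (ψ 1).im) := by
      simp [blochCoord, pauliMatrix, pauliX, Matrix.trace, Matrix.vecMul, dotProduct,
        Matrix.vecMulVec_apply, Fin.sum_univ_two]
      ring
    have h2 : blochCoord ψ 2 = 2 * ((ψ 0).re * (ψ 1).im - (ψ 0).im * (ψ 1).re) := by
      simp [blochCoord, pauliMatrix, pauliY, Matrix.trace, Matrix.vecMul, dotProduct,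
        Matrix.vecMulVec_apply, Fin.sum_univ_two]
      ring
    have h3 : blochCoord ψ 3 = (ψ 0).re * (ψ 0).re + (ψ 0).im * (ψ 0).im -
        ((ψ 1).re * (ψ 1).re + (ψ 1).im * (ψ 1).im) := by
      simp [blochCoord, pauliMatrix, pauliZ, Matrix.trace, Matrix.vecMul, dotProduct,
        Matrix.vecMulVec_apply, Fin.sum_univ_two]
      ring
    rw [h1, h2, h3]
    linear_combination (((ψ 0).re * (ψ 0).re + (ψ 0).im * (ψ 0).im +
      ((ψ 1).re * (ψ 1).re + (ψ 1).im * (ψ 1).im)) + 1) * hψ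
  by_contra hcon
  push Not at hcon
  linarith [hcon 1 (by decide), hcon 2 (by decide), hcon 3 (by decide)]

lemma pauliExpectation_productState {Q : Type*} [Fintype Q] [DecidableEq Q] (ψ : Q → Fin 2 → ℂ)
    (p : Q → Fin 4) : pauliExpectation (productState ψ) p = ∏ q, blochCoord (ψ q) (p q) := by
  have h1 : productState ψ = qubitTensor fun q => Matrix.vecMulVec (ψ q) (star (ψ q)) := by
    ext x y
    simp [productState, qubitTensor, Matrix.vecMulVec_apply, Finset.prod_mul_distrib]
  have h2 : ∀ q, ((blochCoord (ψ q) (p q) : ℝ) : ℂ) =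
      (pauliMatrix (p q) * Matrix.vecMulVec (ψ q) (star (ψ q))).trace := fun q =>
    trace_im_of_isHermitian_mul (pauliMatrix_isHermitian _)
      (by rw [Matrix.conjTranspose_vecMulVec, star_star])
  rw [pauliExpectation, h1, pauliString, qubitTensor_mul, trace_qubitTensor]
  simp only [← h2]
  rw [← Complex.ofReal_prod, Complex.ofReal_re]

/-! ### Paths of small support through the causal cone -/

lemma le_twirlWeight {Q : Type*} [Fintype Q] {m : ℕ} (hm : Fintype.card Q ≤ m)
    {p' p : Q → Fin 4} (h : p' = 0 ↔ p = 0) :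
    (if p = 0 then 1 else ((4 : ℝ) ^ m)⁻¹) ≤ twirlWeight p' p := by
  unfold twirlWeight
  by_cases hp : p = 0
  · simp [hp, h.mpr hp]
  · have h1 := card_pauli_sub_one_pos hp
    have h2 : (4 : ℝ) ^ Fintype.card Q ≤ 4 ^ m := pow_le_pow_right₀ (by norm_num) hm
    simp only [hp, if_false, false_and, ne_eq, not_false_eq_true, true_and, h]
    simp only [if_true]
    exact inv_anti₀ h1 (by linarith)

namespace AlternatingLayout

variable {Q : Type*} [Fintype Q] [DecidableEq Q] {m L : ℕ} (Λ : AlternatingLayout Q m L)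

/-- The shifted positions in one window are distinct elements of an interval of length `m`. -/
lemma card_le_of_mem_layerBlocks (hm : 0 < m) {l : Fin L} {S : Finset Q}
    (hS : S ∈ Λ.layerBlocks l) : S.card ≤ m := by
  simp only [layerBlocks, Finset.mem_filter, Finset.mem_image, Finset.mem_univ, true_and] at hS
  obtain ⟨⟨r, rfl⟩, -⟩ := hS
  set w := Λ.window l r
  let f : Q → ℕ := fun q => (Λ.order q : ℕ) + if Even (l : ℕ) then 0 else m / 2
  have hcard : (Finset.Ico (w * m) (w * m + m)).card = m := by simp
  refine (Finset.card_le_card_of_injOn f ?_ ?_).trans_eq hcard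
  · intro q hq
    have hq' : f q / m = w := (Finset.mem_filter.mp hq).2
    rw [Nat.div_eq_iff hm] at hq'
    rw [Finset.mem_coe, Finset.mem_Ico]
    omega
  · intro q _ q' _ h
    simp only [f, Nat.add_right_cancel_iff] at h
    exact Λ.order.injective (Fin.ext h)

/-- A possible transition of Pauli strings through the layer `l`, which does not increase the
support; the qubits in the blocks of the layer then carry the Pauli matrices `β`. -/
structure IsStep (β : Q → Fin 4) (l : Fin L) (p' p : Q → Fin 4) : Prop where
  card_le : (pauliSupport p').card ≤ (pauliSupport p).card
  uncovered : ∀ q, (∀ S ∈ Λ.layerBlocks l, q ∉ S) → p' q = p q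
  covered : ∀ q, ∀ S ∈ Λ.layerBlocks l, q ∈ S → p' q = 0 ∨ p' q = β q
  block : ∀ S ∈ Λ.layerBlocks l, (∀ q ∈ S, p' q = 0) ↔ ∀ q ∈ S, p q = 0

/-- In every active block replace the whole string by a single Pauli matrix `β` at one
representative qubit. The representative is free, so in a block joining `x` to `y` it can be put at
`y`, which moves the path along the light cone. -/
lemma exists_isStep {β : Q → Fin 4} (hβ : ∀ q, β q ≠ 0) (l : Fin L) (p : Q → Fin 4) {x y : Q}
    (hxy : x = y ∨ ∃ S ∈ Λ.layerBlocks l, x ∈ S ∧ y ∈ S) :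
    ∃ p', Λ.IsStep β l p' p ∧ (p x ≠ 0 → p' y ≠ 0) := by
  classical
  -- The last value `y` is a dummy for inactive blocks, where the representative plays no role.
  let rep : Finset Q → Q := fun S =>
    if x ∈ S ∧ y ∈ S then y else if h : ∃ q ∈ S, p q ≠ 0 then h.choose else y
  have hrep : ∀ S, (∃ q ∈ S, p q ≠ 0) → rep S ∈ S := by
    intro S h
    by_cases h1 : x ∈ S ∧ y ∈ S
    · simp only [rep, if_pos h1, h1.2]
    · simp only [rep, if_neg h1, dif_pos h, h.choose_spec.1]
  let p' : Q → Fin 4 := fun q =>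
    if ∃ S ∈ Λ.layerBlocks l, q ∈ S then
      if ∃ S ∈ Λ.layerBlocks l, (∃ q' ∈ S, p q' ≠ 0) ∧ q = rep S then β q else 0
    else p q
  have hp'rep : ∀ S ∈ Λ.layerBlocks l, (∃ q ∈ S, p q ≠ 0) → p' (rep S) = β (rep S) := by
    intro S hS h
    simp only [p']
    rw [if_pos ⟨S, hS, hrep S h⟩, if_pos ⟨S, hS, h, rfl⟩]
  have hunc : ∀ q, (∀ S ∈ Λ.layerBlocks l, q ∉ S) → p' q = p q := by
    intro q hq
    simp only [p']
    rw [if_neg (by push Not; exact hq)]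
  refine ⟨p', ⟨?_, hunc, ?_, ?_⟩, ?_⟩
  -- `φ` sends a qubit to the representative of its block and fixes idle qubits. It maps the old
  -- support onto a set containing the new one, so the support cannot grow.
  · let φ : Q → Q := fun q => if h : ∃ S ∈ Λ.layerBlocks l, q ∈ S then rep h.choose else q
    refine (Finset.card_le_card (t := (pauliSupport p).image φ) ?_).trans Finset.card_image_le
    intro q hq
    rw [mem_pauliSupport] at hq
    rw [Finset.mem_image]
    by_cases hc : ∃ S ∈ Λ.layerBlocks l, q ∈ S
    · simp only [p', if_pos hc] at hq
      split_ifs at hq with h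
      · obtain ⟨S, hS, ⟨q', hq', hpq'⟩, rfl⟩ := h
        refine ⟨q', mem_pauliSupport.mpr hpq', ?_⟩
        have hex : ∃ S ∈ Λ.layerBlocks l, q' ∈ S := ⟨S, hS, hq'⟩
        simp only [φ, dif_pos hex]
        rw [Λ.layerBlocks_eq_of_mem hex.choose_spec.1 hS hex.choose_spec.2 hq']
      · exact absurd rfl hq
    · refine ⟨q, ?_, by simp only [φ, dif_neg hc]⟩
      rw [mem_pauliSupport, ← hunc q (by push Not at hc; exact hc)]
      exact hq
  · intro q S hS hq
    simp only [p']
    rw [if_pos ⟨S, hS, hq⟩]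
    split_ifs
    · exact Or.inr rfl
    · exact Or.inl rfl
  · intro S hS
    constructor
    · intro h
      by_contra hcon
      push Not at hcon
      exact hβ _ ((hp'rep S hS hcon).symm.trans (h _ (hrep S hcon)))
    · intro h q hq
      simp only [p']
      rw [if_pos ⟨S, hS, hq⟩, if_neg]
      rintro ⟨S', hS', ⟨q', hq', hpq'⟩, hqS'⟩
      have : S' = S := Λ.layerBlocks_eq_of_mem hS' hS (hqS' ▸ hrep S' ⟨q', hq', hpq'⟩) hq
      exact hpq' (h q' (this ▸ hq'))
  · intro hx
    have hcov : ∀ S ∈ Λ.layerBlocks l, x ∈ S → y ∈ S → p' y ≠ 0 := by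
      intro S hS hxS hyS
      have h1 : rep S = y := by simp only [rep, if_pos (And.intro hxS hyS)]
      have h2 := hp'rep S hS ⟨x, hxS, hx⟩
      rw [h1] at h2
      exact h2 ▸ hβ y
    rcases hxy with rfl | ⟨S, hS, hxS, hyS⟩
    · by_cases hc : ∃ S ∈ Λ.layerBlocks l, x ∈ S
      · obtain ⟨S, hS, hxS⟩ := hc
        exact hcov S hS hxS hxS
      · rw [hunc x (by push Not at hc; exact hc)]
        exact hx
    · exact hcov S hS hxS hyS

variable {Λ}

/-- Inactive blocks have weight 1 and active ones at least `4 ^ (-m)`. Active blocks are disjoint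
and each meets the support, so there are at most as many as support qubits. -/
lemma IsStep.le_prod_twirlWeight (hm : 0 < m) {β : Q → Fin 4} {l : Fin L} {p' p : Q → Fin 4}
    (h : Λ.IsStep β l p' p) :
    ((4 : ℝ) ^ m)⁻¹ ^ (pauliSupport p).card ≤ ∏ S : {S // S ∈ Λ.layerBlocks l},
      twirlWeight (fun q : {q // q ∈ S.1} => p' q.1) (fun q => p q.1) := by
  classical
  have hpos : (0 : ℝ) < ((4 : ℝ) ^ m)⁻¹ := by positivity
  have hle : ((4 : ℝ) ^ m)⁻¹ ≤ 1 := inv_le_one_of_one_le₀ (one_le_pow₀ (by norm_num))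
  have hzero : ∀ (p : Q → Fin 4) (S : Finset Q),
      (fun q : {q // q ∈ S} => p q.1) = 0 ↔ ∀ q ∈ S, p q = 0 := by
    intro p S
    simp [funext_iff]
  have h1 : ∀ S : {S // S ∈ Λ.layerBlocks l}, (if (fun q : {q // q ∈ S.1} => p q.1) = 0 then
      1 else ((4 : ℝ) ^ m)⁻¹) ≤
      twirlWeight (fun q : {q // q ∈ S.1} => p' q.1) (fun q => p q.1) := by
    intro S
    refine le_twirlWeight ?_ ?_
    · simpa using Λ.card_le_of_mem_layerBlocks hm S.2
    · rw [hzero, hzero]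
      exact h.block S.1 S.2
  refine le_trans ?_ (Finset.prod_le_prod (fun S _ => ?_) fun S _ => h1 S)
  · rw [Finset.prod_ite, Finset.prod_const_one, one_mul, Finset.prod_const]
    refine pow_le_pow_of_le_one hpos.le hle ?_
    have hex : ∀ S : {S // S ∈ Λ.layerBlocks l},
        ¬ (fun q : {q // q ∈ S.1} => p q.1) = 0 → ∃ q ∈ S.1, p q ≠ 0 := by
      intro S hS
      rw [hzero] at hS
      push Not at hS
      exact hS
    -- Each active block picks a support qubit inside it. The alternative for inactive blocks is an
    -- arbitrary qubit, obtained from the definition of a block as the window of some qubit.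
    refine Finset.card_le_card_of_injOn (fun S => if hS : ∃ q ∈ S.1, p q ≠ 0 then hS.choose
      else (Finset.mem_image.mp (Finset.mem_filter.mp S.2).1).choose) ?_ ?_
    · intro S hS
      have hS' := hex S (Finset.mem_filter.mp hS).2
      simp only [dif_pos hS']
      exact mem_pauliSupport.mpr hS'.choose_spec.2
    · intro S hS S' hS' heq
      have h2 := hex S (Finset.mem_filter.mp hS).2
      have h3 := hex S' (Finset.mem_filter.mp hS').2
      simp only [dif_pos h2, dif_pos h3] at heq
      exact Subtype.ext (Λ.layerBlocks_eq_of_mem S.2 S'.2 h2.choose_spec.1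
        (heq ▸ h3.choose_spec.1))
  · split_ifs
    · exact zero_le_one
    · exact hpos.le

/-- The Pauli strings `P i, …, P L` form a chain of steps. -/
def IsChain (Λ : AlternatingLayout Q m L) (β : Q → Fin 4) (i : ℕ) (P : ℕ → Q → Fin 4) : Prop :=
  ∀ j (hj : j < L), i ≤ j → Λ.IsStep β ⟨j, hj⟩ (P j) (P (j + 1))

lemma IsChain.update {β : Q → Fin 4} {l : ℕ} (hl : l < L) {P : ℕ → Q → Fin 4}
    (hP : Λ.IsChain β (l + 1) P) {p' : Q → Fin 4} (hp' : Λ.IsStep β ⟨l, hl⟩ p' (P (l + 1))) :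
    Λ.IsChain β l (Function.update P l p') := by
  intro j hj hlj
  rcases hlj.eq_or_lt with rfl | h
  · simpa using hp'
  · rw [Function.update_of_ne (by omega), Function.update_of_ne (by omega)]
    exact hP j hj h

/-- Induction along the light cone: each of its rules is matched by one backward step that keeps the
string nontrivial at the tracked qubit. -/
lemma LightCone.exists_isChain {β : Q → Fin 4} (hβ : ∀ q, β q ≠ 0) {p : Q → Fin 4} {l : ℕ} {q : Q}
    (h : Λ.LightCone (pauliSupport p) l q) :
    l ≤ L ∧ ∃ P : ℕ → Q → Fin 4, P L = p ∧ P l q ≠ 0 ∧ Λ.IsChain β l P := by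
  induction h with
  | start hq =>
    exact ⟨le_rfl, fun _ => p, rfl, mem_pauliSupport.mp hq, fun j hj hj' => absurd hj (by omega)⟩
  | @stay l q hl _ ih =>
    obtain ⟨-, P, hPL, hPq, hP⟩ := ih
    obtain ⟨p', hp', hx⟩ := Λ.exists_isStep hβ ⟨l, hl⟩ (P (l + 1)) (Or.inl (rfl : q = q))
    exact ⟨hl.le, Function.update P l p', by rw [Function.update_of_ne hl.ne', hPL],
      by rw [Function.update_self]; exact hx hPq, hP.update hl hp'⟩
  | @spread b q q' _ hq hq' ih =>
    obtain ⟨-, P, hPL, hPq, hP⟩ := ih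
    obtain ⟨p', hp', hx⟩ := Λ.exists_isStep hβ b.1.1 (P (b.1.1 + 1))
      (Or.inr ⟨b.1.2, b.2, hq, hq'⟩)
    have hl := b.1.1.isLt
    exact ⟨hl.le, Function.update P b.1.1 p', by rw [Function.update_of_ne hl.ne', hPL],
      by rw [Function.update_self]; exact hx hPq, hP.update hl hp'⟩

/-- Before the chosen block no qubit needs to be tracked, so any admissible steps down to time 0
will do. -/
lemma IsChain.exists_extend [Nonempty Q] {β : Q → Fin 4} (hβ : ∀ q, β q ≠ 0) {l : ℕ} (hl : l ≤ L)
    {P : ℕ → Q → Fin 4} (hP : Λ.IsChain β l P) :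
    ∃ P' : ℕ → Q → Fin 4, (∀ j, l ≤ j → P' j = P j) ∧ Λ.IsChain β 0 P' := by
  induction l generalizing P with
  | zero => exact ⟨P, fun _ _ => rfl, hP⟩
  | succ l ih =>
    let x := Classical.arbitrary Q
    obtain ⟨p', hp', -⟩ := Λ.exists_isStep hβ ⟨l, hl⟩ (P (l + 1)) (Or.inl (rfl : x = x))
    obtain ⟨P', hP', hch⟩ := ih (Nat.le_of_succ_le hl) (hP.update hl hp')
    refine ⟨P', fun j hj => ?_, hch⟩
    rw [hP' j (by omega), Function.update_of_ne (by omega)]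

lemma IsChain.card_le {β : Q → Fin 4} {P : ℕ → Q → Fin 4} (hP : Λ.IsChain β 0 P) {j : ℕ}
    (hj : j ≤ L) : (pauliSupport (P j)).card ≤ (pauliSupport (P L)).card := by
  induction hj using Nat.decreasingInduction with
  | self => exact le_rfl
  | of_succ j hj ih => exact (hP j hj (Nat.zero_le _)).card_le.trans ih

/-- Going backwards, a qubit takes a value in `{0, β q}` at a block covering it, and later steps
preserve this. A qubit outside all blocks would keep its original Pauli matrix, whose expectation
might vanish; hence the need for covering. -/
lemma IsChain.eq_zero_or_eq {β : Q → Fin 4} {P : ℕ → Q → Fin 4} (hP : Λ.IsChain β 0 P)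
    (hΛ : Λ.Covers) (q : Q) : P 0 q = 0 ∨ P 0 q = β q := by
  obtain ⟨b, hb⟩ := hΛ q
  have hl := b.1.1.isLt
  have key : ∀ j ≤ (b.1.1 : ℕ), P j q = 0 ∨ P j q = β q := by
    intro j hj
    induction hj using Nat.decreasingInduction with
    | self => exact (hP b.1.1 hl (Nat.zero_le _)).covered q b.1.2 b.2 hb
    | of_succ j hj ih =>
      have hstep := hP j (hj.trans hl) (Nat.zero_le _)
      by_cases hc : ∀ S ∈ Λ.layerBlocks ⟨j, hj.trans hl⟩, q ∉ S
      · rw [hstep.uncovered q hc]; exact ih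
      · push Not at hc
        obtain ⟨S, hS, hq⟩ := hc
        exact hstep.covered q S hS hq
  exact key 0 (Nat.zero_le _)

lemma le_pauliExpectation_sq {ψ : Q → Fin 2 → ℂ} (hψ : ∀ q, ∑ i, ‖ψ q i‖ ^ 2 = 1)
    {p : Q → Fin 4} (hp : ∀ q, p q = 0 ∨ 1 / 3 ≤ blochCoord (ψ q) (p q) ^ 2) :
    (1 / 3 : ℝ) ^ (pauliSupport p).card ≤ pauliExpectation (productState ψ) p ^ 2 := by
  rw [pauliExpectation_productState, ← Finset.prod_pow, pauliSupport, ← Finset.prod_const,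
    Finset.prod_filter]
  refine Finset.prod_le_prod (fun q _ => by split_ifs <;> norm_num) fun q _ => ?_
  by_cases h : p q = 0
  · rw [if_neg (not_not.mpr h), h, blochCoord_zero (hψ q), one_pow]
  · rw [if_pos h]
    exact (hp q).resolve_left h

/-- Every Pauli string of weight at most three whose causal cone contains the block `b₀` is the
end point of a path through `b₀` whose weight is at least exponentially small in the depth. -/
theorem exists_path (hm : 0 < m) (hΛ : Λ.Covers) {ψ : Q → Fin 2 → ℂ}
    (hψ : ∀ q, ∑ i, ‖ψ q i‖ ^ 2 = 1) (H : QubitOp Q) {b₀ : Λ.Block} {p : Q → Fin 4}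
    (hcard : (pauliSupport p).card ≤ 3) (hp : Λ.InCausalCone (pauliSupport p) b₀) :
    ∃ path : Fin (L + 1) → Q → Fin 4, path (Fin.last L) = p ∧ Λ.pathOut path b₀ ≠ 0 ∧
      1 / 54 * pauliCoeff H p ^ 2 * (((4 : ℝ) ^ m)⁻¹ ^ 3) ^ L ≤
        Λ.pathCoeff H (productState ψ) path ^ 2 *
          (1 / 2 * ∏ b, twirlWeight (Λ.pathIn path b) (Λ.pathOut path b)) := by
  obtain ⟨q, hq, hcone⟩ := hp
  have : Nonempty Q := ⟨q⟩
  -- The Pauli matrices to be kept on the path are adapted to the input state, so that the final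
  -- expectation is not small.
  choose β hβ hβψ using fun q => exists_blochCoord_sq_ge (hψ q)
  obtain ⟨hl, P₁, hP₁L, hP₁q, hP₁⟩ := hcone.exists_isChain hβ
  obtain ⟨P, hPP₁, hP⟩ := hP₁.exists_extend hβ hl
  have hPL : P L = p := (hPP₁ L hl).trans hP₁L
  have hPq : P (b₀.1.1 + 1) q ≠ 0 := by rw [hPP₁ _ le_rfl]; exact hP₁q
  have hcardP : ∀ j ≤ L, (pauliSupport (P j)).card ≤ 3 := fun j hj =>
    (hP.card_le hj).trans (hPL ▸ hcard)
  let path : Fin (L + 1) → Q → Fin 4 := fun i => P i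
  have hpath : Λ.Consistent path := fun l q hq => (hP l l.isLt (Nat.zero_le _)).uncovered q hq
  have hpos : (0 : ℝ) < ((4 : ℝ) ^ m)⁻¹ := by positivity
  have hle : ((4 : ℝ) ^ m)⁻¹ ≤ 1 := inv_le_one_of_one_le₀ (one_le_pow₀ (by norm_num))
  have hprod : (((4 : ℝ) ^ m)⁻¹ ^ 3) ^ L ≤
      ∏ b, twirlWeight (Λ.pathIn path b) (Λ.pathOut path b) := by
    rw [← Λ.prod_blocks]
    calc (((4 : ℝ) ^ m)⁻¹ ^ 3) ^ L = ∏ _l : Fin L, ((4 : ℝ) ^ m)⁻¹ ^ 3 := by simp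
      _ ≤ _ := Finset.prod_le_prod (fun _ _ => by positivity) fun l _ => ?_
    exact (pow_le_pow_of_le_one hpos.le hle (hcardP (l + 1) l.isLt)).trans
      ((hP l l.isLt (Nat.zero_le _)).le_prod_twirlWeight hm)
  -- At most three qubits survive at time 0, each contributing at least 1/3.
  have hρ : (1 / 27 : ℝ) ≤ pauliExpectation (productState ψ) (P 0) ^ 2 := by
    refine le_trans ?_ (le_pauliExpectation_sq hψ fun q => ?_)
    · calc (1 / 27 : ℝ) = (1 / 3) ^ 3 := by norm_num
        _ ≤ _ := pow_le_pow_of_le_one (by norm_num) (by norm_num) (hcardP 0 (Nat.zero_le _))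
    · rcases hP.eq_zero_or_eq hΛ q with h | h
      · exact Or.inl h
      · exact Or.inr (h ▸ hβψ q)
  refine ⟨path, hPL, fun h => hPq (congr_fun h ⟨q, hq⟩), ?_⟩
  have hcoeff : Λ.pathCoeff H (productState ψ) path =
      pauliExpectation (productState ψ) (P 0) * pauliCoeff H p := by
    rw [pathCoeff, if_pos hpath, ← hPL]
    rfl
  rw [hcoeff, mul_pow]
  calc 1 / 54 * pauliCoeff H p ^ 2 * (((4 : ℝ) ^ m)⁻¹ ^ 3) ^ L =
      (1 / 27 * pauliCoeff H p ^ 2) * (1 / 2 * (((4 : ℝ) ^ m)⁻¹ ^ 3) ^ L) := by ring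
    _ ≤ _ := by gcongr

end AlternatingLayout

/-! ### The lower bound for the gadget Hamiltonian -/

section Bound

variable {n r k m L : ℕ}

-- The squared coefficient of a term is spread over the Pauli strings with its support. Since
-- supports determine terms, each string is counted at most once.
open Classical in
lemma coneWeight_le (G : GadgetData n r k) (hk : 2 ≤ k)
    (Λ : AlternatingLayout (GadgetQubit n r k) m L) (b₀ : Λ.Block) :
    coneWeight G Λ b₀ ≤ ∑ p : GadgetQubit n r k → Fin 4,
      if (pauliSupport p).card ≤ 3 ∧ Λ.InCausalCone (pauliSupport p) b₀ then
        pauliCoeff G.gadgetHamiltonian p ^ 2 else 0 := by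
  rw [coneWeight]
  simp only [← fun T => G.sum_pauliCoeff_gadgetHamiltonian_sq hk T]
  have h1 : ∀ T : G.Term, (if Λ.InCausalCone (G.support T) b₀ then
      ∑ p, (if pauliSupport p = G.support T then pauliCoeff G.gadgetHamiltonian p ^ 2 else 0)
      else 0) = ∑ p, if Λ.InCausalCone (G.support T) b₀ ∧ pauliSupport p = G.support T then
        pauliCoeff G.gadgetHamiltonian p ^ 2 else 0 := by
    intro T
    by_cases h : Λ.InCausalCone (G.support T) b₀ <;> simp [h]
  simp only [h1]
  rw [Finset.sum_comm]
  refine Finset.sum_le_sum fun p _ => ?_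
  by_cases h : ∃ T, Λ.InCausalCone (G.support T) b₀ ∧ pauliSupport p = G.support T
  · obtain ⟨T, hT, hpT⟩ := h
    rw [Finset.sum_eq_single T, if_pos ⟨hT, hpT⟩, if_pos]
    · rw [hpT]
      exact ⟨G.card_support_le T, hT⟩
    · intro T' _ hT'
      exact if_neg fun h' => hT' (G.support_injective (h'.2.symm.trans hpT))
    · simp
  · push Not at h
    rw [Finset.sum_eq_zero fun T _ => if_neg fun h' => h T h'.1 h'.2]
    split_ifs
    · exact sq_nonneg _
    · exact le_rfl

lemma coneWeight_nonneg (G : GadgetData n r k) (Λ : AlternatingLayout (GadgetQubit n r k) m L)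
    (b₀ : Λ.Block) : 0 ≤ coneWeight G Λ b₀ := by
  refine Finset.sum_nonneg fun T _ => ?_
  split_ifs
  · exact sq_nonneg _
  · exact le_rfl

theorem coneWeight_mul_le_variance (hm : 0 < m) {d : ℕ} (hk : 2 ≤ k) (G : GadgetData n r k)
    {Λ : AlternatingLayout (GadgetQubit n r k) m L} (hΛ : Λ.Covers)
    {ψ : GadgetQubit n r k → Fin 2 → ℂ} (hψ : ∀ q, ∑ i, ‖ψ q i‖ ^ 2 = 1)
    {W : (b : Λ.Block) → (Fin d → ℝ) → Λ.BlockUnitary b} {μ : Measure (Fin d → ℝ)}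
    [IsProbabilityMeasure μ] {ν : Fin d} {b₀ : Λ.Block} {F : QubitOp {q // q ∈ b₀.1.2}}
    {A B : (Fin d → ℝ) → Λ.BlockUnitary b₀} (hW : Λ.IsDesignAnsatz W μ ν b₀ F A B) :
    1 / 54 * coneWeight G Λ b₀ * (((4 : ℝ) ^ m)⁻¹ ^ 3) ^ L ≤
      variance (partialDeriv (costFunction G.gadgetHamiltonian (productState ψ)
        fun θ => Λ.circuitOp fun b => W b θ) ν) μ := by
  classical
  refine le_trans ?_ (hW.le_variance_partialDeriv hΛ (G.conjTranspose_gadgetHamiltonian hk)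
    (productState ψ))
  -- Group the paths by their last string; for every string in question one good path is kept.
  rw [← Finset.sum_fiberwise _ fun path : Fin (L + 1) → _ → Fin 4 => path (Fin.last L)]
  calc 1 / 54 * coneWeight G Λ b₀ * (((4 : ℝ) ^ m)⁻¹ ^ 3) ^ L ≤
      1 / 54 * (∑ p : GadgetQubit n r k → Fin 4,
        if (pauliSupport p).card ≤ 3 ∧ Λ.InCausalCone (pauliSupport p) b₀ then
        pauliCoeff G.gadgetHamiltonian p ^ 2 else 0) * (((4 : ℝ) ^ m)⁻¹ ^ 3) ^ L := by
        gcongr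
        exact coneWeight_le G hk Λ b₀
    _ ≤ _ := ?_
  rw [Finset.mul_sum, Finset.sum_mul]
  refine Finset.sum_le_sum fun p _ => ?_
  have hnn : ∀ path : Fin (L + 1) → GadgetQubit n r k → Fin 4,
      0 ≤ if Λ.pathOut path b₀ ≠ 0 then
        Λ.pathCoeff G.gadgetHamiltonian (productState ψ) path ^ 2 *
        (1 / 2 * ∏ b, twirlWeight (Λ.pathIn path b) (Λ.pathOut path b)) else 0 := by
    intro path
    split_ifs
    · exact mul_nonneg (sq_nonneg _) (mul_nonneg (by norm_num)
        (Finset.prod_nonneg fun b _ => twirlWeight_nonneg _ _))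
    · exact le_rfl
  split_ifs with hp
  · obtain ⟨path, hlast, hout, hle⟩ :=
      AlternatingLayout.exists_path hm hΛ hψ G.gadgetHamiltonian hp.1 hp.2
    refine hle.trans ?_
    refine le_trans (le_of_eq ?_) (Finset.single_le_sum (fun path _ => hnn path)
      (Finset.mem_filter.mpr ⟨Finset.mem_univ path, hlast⟩))
    rw [if_pos hout]
  · rw [mul_zero, zero_mul]
    exact Finset.sum_nonneg fun path _ => hnn path

/-- The exponent `6 * m` turns the base 3 into 9 with exponent `3 * m * L`, and `1/9 ≤ 1/4`. -/
lemma three_zpow_neg_pow_le (m L : ℕ) :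
    ((3 : ℝ) ^ (-(L : ℤ))) ^ (6 * m) ≤ (((4 : ℝ) ^ m)⁻¹ ^ 3) ^ L := by
  have h1 : ((3 : ℝ) ^ (-(L : ℤ))) ^ (6 * m) = (9⁻¹ : ℝ) ^ (m * 3 * L) := by
    rw [zpow_neg, zpow_natCast, ← inv_pow, ← pow_mul,
      show L * (6 * m) = 2 * (m * 3 * L) by ring, pow_mul]
    norm_num
  have h2 : (((4 : ℝ) ^ m)⁻¹ ^ 3) ^ L = (4⁻¹ : ℝ) ^ (m * 3 * L) := by
    rw [← inv_pow, ← pow_mul, ← pow_mul, mul_assoc]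
  rw [h1, h2]
  exact pow_le_pow_left₀ (by norm_num) (by norm_num) _

lemma rpow_neg_le_three_zpow_neg_pow (p : ℕ) {L n : ℕ} (hL : 0 < L) {c : ℝ}
    (h : (L : ℝ) ≤ c * Real.log n) :
    (n : ℝ) ^ (-(p * Real.log 3 * c)) ≤ ((3 : ℝ) ^ (-(L : ℤ))) ^ p := by
  have hL' : (0 : ℝ) < L := by exact_mod_cast hL
  have hn : (0 : ℝ) < n := by
    -- For `n = 0` the convention `Real.log 0 = 0` makes the depth bound read `L ≤ 0`, which is
    -- excluded.
    rcases Nat.eq_zero_or_pos n with rfl | hn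
    · simp at h; omega
    · exact_mod_cast hn
  have h3 : 0 < Real.log 3 := Real.log_pos (by norm_num)
  have h1 : ((3 : ℝ) ^ (-(L : ℤ))) ^ p = Real.exp (-(p * Real.log 3 * L)) := by
    rw [← Real.rpow_intCast, ← Real.rpow_natCast, ← Real.rpow_mul (by norm_num),
      Real.rpow_def_of_pos (by norm_num)]
    congr 1
    push_cast
    ring
  rw [h1, Real.rpow_def_of_pos hn]
  apply Real.exp_le_exp.mpr
  have : p * Real.log 3 * L ≤ p * Real.log 3 * (c * Real.log n) :=
    mul_le_mul_of_nonneg_left h (by positivity)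
  linarith

end Bound

theorem mainTheorem4 (m : ℕ) (hm : 2 ≤ m) :
    ∃ a : ℝ, 0 < a ∧ ∃ (p : ℕ) (K : ℝ),
      ∀ (n r k L d : ℕ) (_hk : 2 ≤ k) (G : GadgetData n r k)
        (Λ : AlternatingLayout (GadgetQubit n r k) m L) (_hΛ : Λ.Covers)
        (ψ : GadgetQubit n r k → Fin 2 → ℂ) (_hψ : ∀ q, ∑ i, ‖ψ q i‖ ^ 2 = 1)
        (W : (b : Λ.Block) → (Fin d → ℝ) → Λ.BlockUnitary b)
        (μ : Measure (Fin d → ℝ)) (_hμ : IsProbabilityMeasure μ) (ν : Fin d)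
        (b₀ : Λ.Block) (F : QubitOp {q // q ∈ b₀.1.2})
        (A B : (Fin d → ℝ) → Λ.BlockUnitary b₀)
        (_hW : Λ.IsDesignAnsatz W μ ν b₀ F A B),
        let C : (Fin d → ℝ) → ℝ := costFunction G.gadgetHamiltonian (productState ψ)
          (fun θ => Λ.circuitOp (fun b => W b θ))
        a * coneWeight G Λ b₀ * ((3 : ℝ) ^ (-(L : ℤ))) ^ p ≤ variance (partialDeriv C ν) μ ∧
        ∀ c : ℝ, (L : ℝ) ≤ c * Real.log n →
          a * coneWeight G Λ b₀ * (n : ℝ) ^ (-(K * c)) ≤ variance (partialDeriv C ν) μ := by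
  -- Here `1 / 54` is `1/2` from the gate times `1/27` from the input state, and `K = p * log 3`
  -- rewrites `3 ^ (-p * L)` as a power of `n`.
  refine ⟨1 / 54, by norm_num, 6 * m, ((6 * m : ℕ) : ℝ) * Real.log 3, ?_⟩
  intro n r k L d hk G Λ hΛ ψ hψ W μ hμ ν b₀ F A B hW C
  have hw := coneWeight_nonneg G Λ b₀
  have hmain : 1 / 54 * coneWeight G Λ b₀ * ((3 : ℝ) ^ (-(L : ℤ))) ^ (6 * m) ≤
      variance (partialDeriv C ν) μ :=
    (mul_le_mul_of_nonneg_left (three_zpow_neg_pow_le m L) (by positivity)).trans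
      (coneWeight_mul_le_variance (by omega) hk G hΛ hψ hW)
  refine ⟨hmain, fun c hc => le_trans ?_ hmain⟩
  exact mul_le_mul_of_nonneg_left
    -- The existence of the block `b₀` forces at least one layer.
    (rpow_neg_le_three_zpow_neg_pow (6 * m) b₀.1.1.pos hc) (by positivity)
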